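/- Let $U$ be an open subset of a locally compact metric space $X$ and $f:U\to X$ a continuous map. Conventions. For $A\subset U$ (or $A$ a subset of any space with a self-map $f$), a solution through $x$ in $A$ is a map $\sigma:\mathbb Z\to A$ with $\sigma(0)=x$ and $f(\sigma(n))=\sigma(n+1)$ for all $n$; $\operatorname{Inv}A$ is the set of $x\in A$ having a solution through $x$ in $A$. A compact set $N\subset U$ is an isolating neighbourhood if $\operatorname{Inv}N\subset\operatorname{Int}N$, and then $\operatorname{Inv} N$ is called an isolated invariant set. Put $\omega(x)=\bigcap_{N}\operatorname{cl}\{f^n(x):n>N\}$ and $\alpha(\sigma)=\bigcap_N\operatorname{cl}\{\sigma(-n):n>N\}$. For sets $B,C$, the connecting orbits $C(B,C;S)$ are the points $x\in S\setminus(B\cup C)$ with a solution $\sigma$ in $S$ through $x$ such that $\alpha(\sigma)\subset B$ and $\omega(x)\subset C$. A Morse decomposition $\mathcal M(\mathcal P,<)=\{M_p\subset S:p\in\mathcal P\}$ of an isolated invariant set $S$, indexed by a finite partially ordered set $\mathcal P$, is a family of pairwise disjoint isolated invariant sets such that for every $x\in S$ and every solution $\sigma$ in $S$ through $x$, either $\sigma(\mathbb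 Z)\subset M_p$ for some $p$, or $\omega(x)\subset M_p$ and $\alpha(\sigma)\subset M_q$ for some $p<q$. A set $I\subset\mathcal P$ is an interval if $p<r<q$ and $p,q\in I$ imply $r\in I$, and is attracting if $r<q$, $q\in I$ imply $r\in I$; $M_I=\bigcup_{p\in I}M_p\cup\bigcup_{q,r\in I}C(M_q,M_r;S)$. An attracting neighbourhood of a set $A$ is a compact neighbourhood $V$ of $A$ with $f(V)\subset\operatorname{Int}V$ and $A=\bigcap_{n>0}f^n(V)$; the dual repeller of $A$ in $V$ is $\{x\in\operatorname{Inv}V:\omega(x)\cap A=\emptyset\}$. A filtration pair for $S$ is a pair of compact sets $L\subset N\subset U$, each the closure of its interior, such that $\operatorname{cl}(N\setminus L)$ is an isolating neighbourhood with $\operatorname{Inv}\operatorname{cl}(N\setminus L)=S$, $L$ is a neighbourhood in $N$ of $\{x\in N:f(x)\notin\operatorname{Int}N\}$, and $f(L)\cap\operatorname{cl}(N\setminus L)=\emptyset$. Its pointed space is $N_L=N/L$ with base point $[L]$ (if $L=\emptyset$, $N_L$ is $N$ with a disjoint base point), and the pointed space map $f_P:N_L\to N_L$ fixes $[L]$ and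 sends $x\in N\setminus L$ to the class of $f(x)$. Put $\hat S=\operatorname{Inv}N_L$ (for $f_P$), $\hat{\mathcal P}=\mathcal P\cup\{0\}$ with $0<p$ for all $p\in\mathcal P$, $\hat M_0=\{[L]\}$ and $\hat M_p=$ the image of $M_p$ in $N_L$; $\hat M_J$, for $J\subset\hat{\mathcal P}$, is formed as above with $\hat S$ and $f_P$. Theorem. Let $\mathcal M(\mathcal P,<)$ be a Morse decomposition of an isolated invariant set $S$ and let $I\subset\mathcal P$ be an interval. Then: (1) $M_I$ is an isolated invariant set. (2) If $Y\subset U$ is compact with $f(Y)\subset\operatorname{Int}Y$ and $S=\operatorname{Inv}Y$, then there are attracting intervals $J_0,J_1\subset\mathcal P$ with $J_1=J_0\sqcup I$ and attracting neighbourhoods $U_0\subset U_1\subset Y$ of $M_{J_0}$ and $M_{J_1}$ such that $M_I$ is the dual repeller of $M_{J_0}$ in $U_1$, and $U_1\setminus\operatorname{Int}U_0$ is an isolating neighbourhood with maximal invariant subset $M_I$. (3) In general, $S$ has a filtration pair, and for every filtration pair $(N,L)$ of $S$ the same holds in the pointed space: there are attracting intervals $J_0,J_1\subset\hat{\mathcal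 P}$ with $J_1=J_0\sqcup I$ and attracting neighbourhoods $U_0\subset U_1\subset N_L$ (for $f_P$) of $\hat M_{J_0}$ and $\hat M_{J_1}$ such that the image of $M_I$ in $N_L$ is the dual repeller of $\hat M_{J_0}$ in $U_1$, and $U_1\setminus\operatorname{Int}U_0$ is an isolating neighbourhood for $f_P$ whose maximal invariant subset is the image of $M_I$. -/

import Mathlib

open Set Topology

namespace ConleyMorse

section Dynamics

variable {X : Type*}

/-- `σ` is a solution through `x` in `A`: a complete orbit of `f` contained in `A` with
`σ 0 = x`. -/
def IsSolution (f : X → X) (A : Set X) (x : X) (σ : ℤ → X) : Prop :=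
  σ 0 = x ∧ ∀ n : ℤ, σ n ∈ A ∧ f (σ n) = σ (n + 1)

/-- The maximal invariant subset of `A`. -/
def Inv (f : X → X) (A : Set X) : Set X :=
  {x | ∃ σ : ℤ → X, IsSolution f A x σ}

variable [TopologicalSpace X]

/-- The `ω`-limit set of `x`. -/
def omegaSet (f : X → X) (x : X) : Set X :=
  ⋂ N : ℕ, closure {y | ∃ n : ℕ, N < n ∧ f^[n] x = y}

/-- The `α`-limit set of a solution. -/
def alphaSet (σ : ℤ → X) : Set X :=
  ⋂ N : ℕ, closure {y | ∃ n : ℕ, N < n ∧ σ (-(n : ℤ)) = y}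

/-- `N` is an isolating neighbourhood for the map `f` with domain `D`. -/
def IsIsolatingNbhd (f : X → X) (D N : Set X) : Prop :=
  IsCompact N ∧ N ⊆ D ∧ Inv f N ⊆ interior N

/-- `S` is an isolated invariant set of the map `f` with domain `D`. -/
def IsIsolatedInvariant (f : X → X) (D S : Set X) : Prop :=
  ∃ N : Set X, IsIsolatingNbhd f D N ∧ S = Inv f N

/-- The exit set of `N`. -/
def exitSet (f : X → X) (N : Set X) : Set X :=
  {x | x ∈ N ∧ f x ∉ interior N}

/-- `(N, L)` is a filtration pair for `S`. -/
structure IsFiltrationPair (f : X → X) (D S N L : Set X) : Prop where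
  compact_N : IsCompact N
  compact_L : IsCompact L
  L_subset_N : L ⊆ N
  N_subset : N ⊆ interior D
  regular_N : N = closure (interior N)
  regular_L : L = closure (interior L)
  isolating : IsIsolatingNbhd f D (closure (N \ L))
  inv_eq : S = Inv f (closure (N \ L))
  nbhd_exit : ∃ O : Set X, IsOpen O ∧ exitSet f N ⊆ O ∧ O ∩ N ⊆ L
  disjoint_image : f '' L ∩ closure (N \ L) = ∅

/-- The connecting orbits from `B` to `C` in `Y`. -/
def connectingOrbits (f : X → X) (B C Y : Set X) : Set X :=
  {x | x ∈ Y \ (B ∪ C) ∧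
    ∃ σ : ℤ → X, IsSolution f Y x σ ∧ alphaSet σ ⊆ B ∧ omegaSet f x ⊆ C}

/-- `U` is an attracting neighbourhood of the attractor `A`. -/
structure IsAttractingNbhd (f : X → X) (D U A : Set X) : Prop where
  compact : IsCompact U
  subset_domain : U ⊆ D
  nbhd : A ⊆ interior U
  image_subset : f '' U ⊆ interior U
  eq_iInter : A = ⋂ n : {n : ℕ // 0 < n}, f^[(n : ℕ)] '' U

/-- The dual repeller of `A` for the system on `Y`. If `Y` is invariant then `Inv f Y = Y`. -/
def dualRepeller (f : X → X) (Y A : Set X) : Set X :=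
  {x | x ∈ Inv f Y ∧ omegaSet f x ∩ A = ∅}

/-- `M` is a Morse decomposition, indexed by the partially ordered set `P`, of `S`. -/
structure IsMorseDecomposition {P : Type*} [PartialOrder P]
    (f : X → X) (D S : Set X) (M : P → Set X) : Prop where
  subset : ∀ p, M p ⊆ S
  isolated : ∀ p, IsIsolatedInvariant f D (M p)
  disjoint : ∀ p q, p ≠ q → Disjoint (M p) (M q)
  solution : ∀ x ∈ S, ∀ σ : ℤ → X, IsSolution f S x σ →
    (∃ p, ∀ n, σ n ∈ M p) ∨
    (∃ p q, p < q ∧ omegaSet f x ⊆ M p ∧ alphaSet σ ⊆ M q)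

/-- The set `M_I`: the Morse sets with index in `I` and the connecting orbits between them. -/
def morseSet {P : Type*} (f : X → X) (S : Set X) (M : P → Set X) (I : Set P) : Set X :=
  (⋃ p ∈ I, M p) ∪ ⋃ q ∈ I, ⋃ r ∈ I, connectingOrbits f (M q) (M r) S

/-- `R` is realised, inside `Y`, as a dual repeller between two nested attracting
neighbourhoods: there are attracting intervals `J₀` and `J₁ = J₀ ⊔ I` and attracting
neighbourhoods `U₀ ⊆ U₁ ⊆ Y` of `M_{J₀}` and `M_{J₁}` such that `R` is the dual repeller of
`M_{J₀}` in `U₁`, and `U₁ \ Int U₀` is an isolating neighbourhood of `R`. -/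
def IsRealisedBetween {P : Type*} [PartialOrder P]
    (f : X → X) (D S : Set X) (M : P → Set X) (I : Set P) (Y R : Set X) : Prop :=
  ∃ J₀ J₁ : Set P, IsLowerSet J₀ ∧ IsLowerSet J₁ ∧ Disjoint J₀ I ∧ J₁ = J₀ ∪ I ∧
    ∃ U₀ U₁ : Set X, U₀ ⊆ U₁ ∧ U₁ ⊆ Y ∧
      IsAttractingNbhd f D U₀ (morseSet f S M J₀) ∧
      IsAttractingNbhd f D U₁ (morseSet f S M J₁) ∧
      R = dualRepeller f U₁ (morseSet f S M J₀) ∧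
      IsIsolatingNbhd f D (U₁ \ interior U₀) ∧
      R = Inv f (U₁ \ interior U₀)

end Dynamics

section Pointed

variable {X : Type*}

/-- The subset `L ⊔ {pt}` of `N ⊔ {pt}`. -/
def collapsed (N L : Set X) : Set (N ⊕ Unit) :=
  {a | ∀ x : N, a = Sum.inl x → (x : X) ∈ L}

/-- The equivalence relation on `N ⊔ {pt}` that collapses `L ⊔ {pt}` to one point. -/
def collapseSetoid (N L : Set X) : Setoid (N ⊕ Unit) where
  r a b := a = b ∨ (a ∈ collapsed N L ∧ b ∈ collapsed N L)
  iseqv :=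
    { refl := fun _ => Or.inl rfl
      symm := by
        rintro a b (h | h)
        · exact Or.inl h.symm
        · exact Or.inr ⟨h.2, h.1⟩
      trans := by
        rintro a b c (rfl | h) (rfl | k)
        · exact Or.inl rfl
        · exact Or.inr k
        · exact Or.inr h
        · exact Or.inr ⟨h.1, k.2⟩ }

/-- The pointed space `N_L = N / L`, presented as `(N ⊔ {pt}) / (L ⊔ {pt})`. For nonempty `L`
this is the quotient of `N` by `L`, and for empty `L` it is `N` with a disjoint point. -/
def PointedSpace (N L : Set X) : Type _ := Quotient (collapseSetoid N L)

instance [TopologicalSpace X] (N L : Set X) : TopologicalSpace (PointedSpace N L) :=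
  inferInstanceAs (TopologicalSpace (Quotient (collapseSetoid N L)))

/-- The quotient map `N → N_L`. -/
def toPointed (N L : Set X) (x : N) : PointedSpace N L :=
  Quotient.mk (collapseSetoid N L) (Sum.inl x)

/-- The base point `[L]`. -/
def basePoint (N L : Set X) : PointedSpace N L :=
  Quotient.mk (collapseSetoid N L) (Sum.inr ())

/-- The subset of `N_L` that is the image of `A ∩ N`. -/
def pointedImage (N L A : Set X) : Set (PointedSpace N L) :=
  toPointed N L '' {x : N | (x : X) ∈ A}

open Classical in
/-- The lift of the pointed space map to `N ⊔ {pt}`. A point `x ∈ N \ L` goes to the class of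
`f x`, which lies in `N` when `(N, L)` is a filtration pair; the rest goes to `[L]`. -/
noncomputable def pointedMapAux (f : X → X) (N L : Set X) : N ⊕ Unit → PointedSpace N L
  | Sum.inl x =>
      if h : (x : X) ∉ L ∧ f x ∈ N then toPointed N L ⟨f x, h.2⟩ else basePoint N L
  | Sum.inr _ => basePoint N L

theorem pointedMapAux_of_collapsed (f : X → X) (N L : Set X) (a : N ⊕ Unit)
    (ha : a ∈ collapsed N L) : pointedMapAux f N L a = basePoint N L := by
  cases a with
  | inl x =>
    have hx : (x : X) ∈ L := ha x rfl
    simp [pointedMapAux, hx]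
  | inr _ => rfl

/-- The pointed space map `f_P : N_L → N_L`. -/
noncomputable def pointedMap (f : X → X) (N L : Set X) : PointedSpace N L → PointedSpace N L :=
  Quotient.lift (pointedMapAux f N L) (by
    rintro a b (rfl | h)
    · rfl
    · rw [pointedMapAux_of_collapsed f N L a h.1, pointedMapAux_of_collapsed f N L b h.2])

/-- The family of Morse sets in `N_L` associated to `M`, indexed by `P` with a new least
element `⊥`: the base point belongs to `⊥`, and the image of `M p` belongs to `p`. -/
def associatedMorse {P : Type*} (N L : Set X) (M : P → Set X) :
    WithBot P → Set (PointedSpace N L)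
  | ⊥ => {basePoint N L}
  | (p : P) => pointedImage N L (M p)

end Pointed

end ConleyMorse

/-! First suppose `S = Inv f Y` with `f(Y) ⊆ Int Y`. Take `J₁` to be the lower closure of `I` and
`J₀ = J₁ \ I`; both are attracting because `I` is an interval. The core claim is that `M_J` is an
attractor for every attracting `J`. The closure of `M_J` misses each `M_p` with `p ∉ J`
(`disjoint_closure_morseSet`), so some compact neighbourhood `V` of `M_J` avoids all those Morse
sets. A backward orbit in `V` has its α-limit set in some `M_q` with `q ∈ J`, or lies in one such
Morse set; since indices decrease along orbits, its endpoint is in `M_J`. This backward condition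
alone yields an attracting neighbourhood: the points of `V` with an infinite backward pseudo-orbit
in `V`, for a small enough error (`exists_isAttractingNbhd`). The set `M_I` is then what remains of
`M_{J₁}` once the points attracted to `M_{J₀}` are removed.

In general, collapsing the exit region makes the whole space play the role of `Y`. Pseudo-orbits
produce an isolating block, the block produces a filtration pair, and `N_L` is compact Hausdorff
with `f_P` continuous. The base point and the images of the `M_p` form a Morse decomposition there.
The delicate orbits are those that fall into the base point: only their backward halves lift to `X`,
and these need not lie in `S`. Their α-limit sets still lie in a single Morse set, because a
backward orbit that comes close enough to a suitable maximal Morse set is trapped near it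
(`exists_backward_trapping`, `exists_alphaSet_subset`). The same trapping gives the disjointness
used above.

Finally, the quotient map is injective and open near `S`, so isolation of the image of `M_I` in
`N_L` pulls back to isolation of `M_I` in `X`. -/

namespace ConleyMorse

/-! ### Decreasing families of compact sets -/

section Compactness

variable {X : Type*} [TopologicalSpace X]

/-- The fibres over `y` in the sets `closure (T n)` are nested nonempty compact sets. This is used
both for a self-map, to get invariance of limit sets, and for the quotient map to `N_L`, to
transport them. -/
theorem iInter_closure_image_subset {Z : Type*} [TopologicalSpace Z] [T2Space X] [T2Space Z]
    {K : Set X} (hK : IsCompact K) {e : X → Z} (he : ContinuousOn e K) {T : ℕ → Set X}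
    (hT : Antitone T) (hTK : ∀ n, T n ⊆ K) :
    ⋂ n, closure (e '' T n) ⊆ e '' ⋂ n, closure (T n) := by
  intro y hy
  have hcl : ∀ n, closure (T n) ⊆ K := fun n => closure_minimal (hTK n) hK.isClosed
  have hcpt : ∀ n, IsCompact (closure (T n)) := fun n =>
    hK.of_isClosed_subset isClosed_closure (hcl n)
  have hclosed : ∀ n, IsClosed (closure (T n) ∩ e ⁻¹' {y}) := fun n =>
    (he.mono (hcl n)).preimage_isClosed_of_isClosed isClosed_closure isClosed_singleton
  have hne : (⋂ n, (closure (T n) ∩ e ⁻¹' {y})).Nonempty := by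
    refine IsCompact.nonempty_iInter_of_sequence_nonempty_isCompact_isClosed _ ?_ ?_ ?_ hclosed
    · intro n
      exact inter_subset_inter_left _ (closure_mono (hT n.le_succ))
    · intro n
      have hsub : closure (e '' T n) ⊆ e '' closure (T n) :=
        closure_minimal (image_mono subset_closure)
          ((hcpt n).image_of_continuousOn (he.mono (hcl n))).isClosed
      obtain ⟨x, hx, hxy⟩ := hsub (mem_iInter.1 hy n)
      exact ⟨x, hx, hxy⟩
    · exact (hcpt 0).of_isClosed_subset (hclosed 0) inter_subset_left
  obtain ⟨x, hx⟩ := hne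
  rw [mem_iInter] at hx
  exact ⟨x, mem_iInter.2 fun n => (hx n).1, (hx 0).2⟩

theorem image_iInter_closure_subset {Z : Type*} [TopologicalSpace Z] [T2Space X]
    {K : Set X} (hK : IsCompact K) {e : X → Z} (he : ContinuousOn e K) {T : ℕ → Set X}
    (hTK : ∀ n, T n ⊆ K) :
    e '' (⋂ n, closure (T n)) ⊆ ⋂ n, closure (e '' T n) := by
  rintro _ ⟨x, hx, rfl⟩
  refine mem_iInter.2 fun n => ?_
  have hxn := mem_iInter.1 hx n
  have hxK : x ∈ K := closure_minimal (hTK n) hK.isClosed hxn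
  exact ((he x hxK).mono (hTK n)).mem_closure_image hxn

/-- One source for the invariance of ω-limits, α-limits, closures and intersections of iterated
images: in each case `f` shifts the tails by at most one index. -/
theorem image_iInter_closure_eq [T2Space X] {K : Set X} (hK : IsCompact K) {f : X → X}
    (hf : ContinuousOn f K) {T : ℕ → Set X} (hT : Antitone T) (hTK : ∀ n, T n ⊆ K)
    (h₁ : ∀ n, f '' T (n + 1) ⊆ T n) (h₂ : ∀ n, T (n + 1) ⊆ f '' T n) :
    f '' (⋂ n, closure (T n)) = ⋂ n, closure (T n) := by
  apply Subset.antisymm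
  · intro y hy
    have hy' := mem_iInter.1 (image_iInter_closure_subset hK hf hTK hy)
    exact mem_iInter.2 fun n => closure_mono (h₁ n) (hy' (n + 1))
  · intro y hy
    apply iInter_closure_image_subset hK hf hT hTK
    exact mem_iInter.2 fun n => closure_mono (h₂ n) (mem_iInter.1 hy (n + 1))

theorem image_closure_eq [T2Space X] {K : Set X} (hK : IsCompact K) {f : X → X}
    (hf : ContinuousOn f K) {A : Set X} (hAK : A ⊆ K) (hA : f '' A = A) :
    f '' closure A = closure A := by
  have := image_iInter_closure_eq hK hf (T := fun _ => A) antitone_const (fun _ => hAK)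
    (fun _ => hA.subset) (fun _ => hA.symm.subset)
  simpa [iInter_const] using this

theorem nonempty_iInter_closure [T2Space X] {K : Set X} (hK : IsCompact K)
    {T : ℕ → Set X} (hT : Antitone T) (hTK : ∀ n, T n ⊆ K) (hne : ∀ n, (T n).Nonempty) :
    (⋂ n, closure (T n)).Nonempty := by
  have hcl : ∀ n, closure (T n) ⊆ K := fun n => closure_minimal (hTK n) hK.isClosed
  exact IsCompact.nonempty_iInter_of_sequence_nonempty_isCompact_isClosed _
    (fun n => closure_mono (hT n.le_succ)) (fun n => (hne n).closure)
    (hK.of_isClosed_subset isClosed_closure (hcl 0)) (fun _ => isClosed_closure)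

theorem iInter_closure_subset [T2Space X] {K : Set X} (hK : IsCompact K)
    {T : ℕ → Set X} (hTK : ∀ n, T n ⊆ K) : (⋂ n, closure (T n)) ⊆ K :=
  (iInter_subset _ 0).trans (closure_minimal (hTK 0) hK.isClosed)

theorem exists_subset_of_iInter_closure [T2Space X] {K : Set X} (hK : IsCompact K)
    {T : ℕ → Set X} (hT : Antitone T) (hTK : ∀ n, T n ⊆ K) {G : Set X}
    (hG : ∀ x ∈ ⋂ n, closure (T n), G ∈ 𝓝 x) : ∃ n, T n ⊆ G := by
  obtain ⟨n, hn⟩ := exists_subset_nhds_of_isCompact (V := fun n => closure (T n))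
    (directed_of_isDirected_le fun _ _ h => closure_mono (hT h))
    (fun n => hK.of_isClosed_subset isClosed_closure (closure_minimal (hTK n) hK.isClosed)) hG
  exact ⟨n, subset_closure.trans hn⟩

end Compactness

/-! ### Solutions -/

section Solutions

variable {X : Type*} {f : X → X} {A B : Set X} {x : X} {σ : ℤ → X}

theorem IsSolution.mono (h : IsSolution f A x σ) (hAB : A ⊆ B) : IsSolution f B x σ :=
  ⟨h.1, fun n => ⟨hAB (h.2 n).1, (h.2 n).2⟩⟩

theorem IsSolution.shift (h : IsSolution f A x σ) (k : ℤ) :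
    IsSolution f A (σ k) fun n => σ (k + n) :=
  ⟨by simp, fun n => ⟨(h.2 _).1, by rw [(h.2 _).2, add_assoc]⟩⟩

theorem IsSolution.mem_inv (h : IsSolution f A x σ) (k : ℤ) : σ k ∈ Inv f A :=
  ⟨_, h.shift k⟩

theorem IsSolution.mem (h : IsSolution f A x σ) : x ∈ A := h.1 ▸ (h.2 0).1

theorem IsSolution.to_inv (h : IsSolution f A x σ) : IsSolution f (Inv f A) x σ :=
  ⟨h.1, fun n => ⟨h.mem_inv n, (h.2 n).2⟩⟩

theorem IsSolution.iterate (h : IsSolution f A x σ) (n : ℕ) : f^[n] x = σ n := by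
  induction n with
  | zero => simp [h.1]
  | succ k ih => rw [Function.iterate_succ_apply', ih, (h.2 _).2]; simp

theorem IsSolution.backward {A : Set X} (h : IsSolution f A x σ) (n : ℕ) :
    f (σ (-((n + 1 : ℕ) : ℤ))) = σ (-(n : ℤ)) := by
  rw [(h.2 _).2]
  congr 1
  push_cast
  ring

theorem IsSolution.iterate_add (h : IsSolution f A x σ) (k : ℤ) (n : ℕ) :
    f^[n] (σ k) = σ (k + n) := (h.shift k).iterate n

theorem inv_subset : Inv f A ⊆ A := fun _ ⟨_, h⟩ => h.mem

theorem inv_mono (h : A ⊆ B) : Inv f A ⊆ Inv f B := fun _ ⟨σ, hσ⟩ => ⟨σ, hσ.mono h⟩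

theorem inv_inv : Inv f (Inv f A) = Inv f A :=
  inv_subset.antisymm fun _ ⟨σ, h⟩ => ⟨σ, h.to_inv⟩

theorem image_inv : f '' Inv f A = Inv f A := by
  apply Subset.antisymm
  · rintro _ ⟨x, ⟨σ, h⟩, rfl⟩
    have := h.iterate 1
    simp only [Function.iterate_one, Nat.cast_one] at this
    exact this ▸ h.mem_inv 1
  · rintro x ⟨σ, h⟩
    refine ⟨σ (-1), h.mem_inv _, ?_⟩
    rw [(h.2 _).2]
    simpa using h.1

theorem exists_isSolution_of_backward {b : ℕ → X} (hb : ∀ n, b n ∈ A)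
    (hfb : ∀ n, f (b (n + 1)) = b n) (hfwd : ∀ n, f^[n] (b 0) ∈ A) :
    ∃ σ, IsSolution f A (b 0) σ ∧ ∀ n : ℕ, σ (-(n : ℤ)) = b n := by
  let σ : ℤ → X := fun n => match n with
    | Int.ofNat k => f^[k] (b 0)
    | Int.negSucc k => b (k + 1)
  refine ⟨σ, ⟨rfl, fun n => ?_⟩, fun n => ?_⟩
  · match n with
    | Int.ofNat k => exact ⟨hfwd k, (Function.iterate_succ_apply' f k (b 0)).symm⟩
    | Int.negSucc 0 => exact ⟨hb 1, hfb 0⟩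
    | Int.negSucc (k + 1) =>
      exact ⟨hb (k + 2), hfb (k + 1)⟩
  · match n with
    | 0 => rfl
    | k + 1 => rfl

theorem subset_inv_of_image_eq {C : Set X} (hC : f '' C = C) (hCA : C ⊆ A) : C ⊆ Inv f A := by
  intro x hx
  have hex : ∀ y : C, ∃ z : C, f z = y := by
    rintro ⟨y, hy⟩
    rw [← hC] at hy
    obtain ⟨z, hz, rfl⟩ := hy
    exact ⟨⟨z, hz⟩, rfl⟩
  choose g hg using hex
  have hmaps : MapsTo f C C := mapsTo_iff_image_subset.2 hC.subset
  obtain ⟨σ, hσ, -⟩ := exists_isSolution_of_backward (f := f) (A := A)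
    (b := fun n => (g^[n] ⟨x, hx⟩ : C)) (fun n => hCA (g^[n] ⟨x, hx⟩).2)
    (fun n => by rw [Function.iterate_succ_apply', hg]) (fun n => hCA (hmaps.iterate n hx))
  exact ⟨σ, hσ⟩

theorem image_iterate_eq {C : Set X} (hC : f '' C = C) (n : ℕ) : f^[n] '' C = C := by
  induction n with
  | zero => simp
  | succ k ih => rw [Function.iterate_succ, image_comp, hC, ih]

variable [TopologicalSpace X] [T2Space X]

theorem isCompact_inv (hA : IsCompact A) (hf : ContinuousOn f A) : IsCompact (Inv f A) := by
  have h : closure (Inv f A) ⊆ A := closure_minimal inv_subset hA.isClosed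
  have h' : closure (Inv f A) ⊆ Inv f A :=
    subset_inv_of_image_eq (image_closure_eq hA hf inv_subset image_inv) h
  exact hA.of_isClosed_subset (isClosed_of_closure_subset h') inv_subset

theorem inv_eq_iInter_image (hA : IsCompact A) (hf : ContinuousOn f A) (hmaps : f '' A ⊆ A) :
    Inv f A = ⋂ n : {n : ℕ // 0 < n}, f^[(n : ℕ)] '' A := by
  have hm : MapsTo f A A := mapsTo_iff_image_subset.2 hmaps
  have hiter : ∀ n, ContinuousOn (f^[n]) A := fun n => hf.iterate hm n
  have hanti : Antitone fun n => f^[n] '' A := by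
    refine antitone_nat_of_succ_le fun n => ?_
    rw [Function.iterate_succ, image_comp]
    exact image_mono hmaps
  have hTA : ∀ n, f^[n] '' A ⊆ A := fun n => mapsTo_iff_image_subset.1 (hm.iterate n)
  have hcl : ∀ n, closure (f^[n] '' A) = f^[n] '' A := fun n =>
    (hA.image_of_continuousOn (hiter n)).isClosed.closure_eq
  have hsucc : ∀ n, f '' (f^[n] '' A) = f^[n + 1] '' A := fun n => by
    rw [Function.iterate_succ', image_comp]
  have heq := image_iInter_closure_eq hA hf hanti hTA
    (fun n => (hsucc _).subset.trans (hanti (by omega))) (fun n => (hsucc n).symm.subset)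
  simp only [hcl] at heq
  apply Subset.antisymm
  · refine subset_iInter fun n => ?_
    rw [← image_iterate_eq (image_inv (f := f) (A := A)) n]
    exact image_mono inv_subset
  -- The index set omits `n = 0`, which is harmless because the images decrease.
  · have hsub : (⋂ n : {n : ℕ // 0 < n}, f^[(n : ℕ)] '' A) ⊆ ⋂ n, f^[n] '' A := by
      intro x hx
      rw [mem_iInter] at hx ⊢
      exact fun n => hanti n.le_succ (hx ⟨n + 1, n.succ_pos⟩)
    exact hsub.trans (subset_inv_of_image_eq heq ((iInter_subset _ 0).trans (hTA 0)))

end Solutions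

/-! ### Limit sets -/

section LimitSets

variable {X : Type*} {f : X → X} {K : Set X} {x : X} {σ : ℤ → X}

theorem antitone_omega_tail (f : X → X) (x : X) :
    Antitone fun N : ℕ => {y | ∃ n : ℕ, N < n ∧ f^[n] x = y} :=
  fun _ _ h _ ⟨n, hn, e⟩ => ⟨n, h.trans_lt hn, e⟩

theorem antitone_alpha_tail (σ : ℤ → X) :
    Antitone fun N : ℕ => {y | ∃ n : ℕ, N < n ∧ σ (-(n : ℤ)) = y} :=
  fun _ _ h _ ⟨n, hn, e⟩ => ⟨n, h.trans_lt hn, e⟩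

theorem omega_tail_subset (h : ∀ n, f^[n] x ∈ K) (N : ℕ) :
    {y | ∃ n : ℕ, N < n ∧ f^[n] x = y} ⊆ K := by
  rintro _ ⟨n, -, rfl⟩; exact h n

theorem alpha_tail_subset (h : ∀ n : ℕ, σ (-(n : ℤ)) ∈ K) (N : ℕ) :
    {y | ∃ n : ℕ, N < n ∧ σ (-(n : ℤ)) = y} ⊆ K := by
  rintro _ ⟨n, -, rfl⟩; exact h n

variable [TopologicalSpace X]

theorem omegaSet_subset [T2Space X] (hK : IsCompact K) (h : ∀ n, f^[n] x ∈ K) :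
    omegaSet f x ⊆ K := iInter_closure_subset hK (omega_tail_subset h)

theorem alphaSet_subset [T2Space X] (hK : IsCompact K) (h : ∀ n : ℕ, σ (-(n : ℤ)) ∈ K) :
    alphaSet σ ⊆ K := iInter_closure_subset hK (alpha_tail_subset h)

theorem omegaSet_nonempty [T2Space X] (hK : IsCompact K) (h : ∀ n, f^[n] x ∈ K) :
    (omegaSet f x).Nonempty :=
  nonempty_iInter_closure hK (antitone_omega_tail f x) (omega_tail_subset h)
    fun N => ⟨_, N + 1, N.lt_succ_self, rfl⟩

theorem alphaSet_nonempty [T2Space X] (hK : IsCompact K) (h : ∀ n : ℕ, σ (-(n : ℤ)) ∈ K) :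
    (alphaSet σ).Nonempty :=
  nonempty_iInter_closure hK (antitone_alpha_tail σ) (alpha_tail_subset h)
    fun N => ⟨_, N + 1, N.lt_succ_self, rfl⟩

theorem image_omegaSet [T2Space X] (hK : IsCompact K) (hf : ContinuousOn f K)
    (h : ∀ n, f^[n] x ∈ K) : f '' omegaSet f x = omegaSet f x := by
  refine image_iInter_closure_eq hK hf (antitone_omega_tail f x) (omega_tail_subset h) ?_ ?_
  · rintro N _ ⟨_, ⟨n, hn, rfl⟩, rfl⟩
    exact ⟨n + 1, by omega, Function.iterate_succ_apply' f n x⟩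
  · rintro N _ ⟨n, hn, rfl⟩
    obtain ⟨m, rfl⟩ : ∃ m, n = m + 1 := ⟨n - 1, by omega⟩
    exact ⟨_, ⟨m, by omega, rfl⟩, (Function.iterate_succ_apply' f m x).symm⟩

theorem image_alphaSet [T2Space X] (hK : IsCompact K) (hf : ContinuousOn f K)
    (h : ∀ n : ℕ, σ (-(n : ℤ)) ∈ K) (hσ : ∀ n : ℕ, f (σ (-((n + 1 : ℕ) : ℤ))) = σ (-(n : ℤ))) :
    f '' alphaSet σ = alphaSet σ := by
  refine image_iInter_closure_eq hK hf (antitone_alpha_tail σ) (alpha_tail_subset h) ?_ ?_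
  · rintro N _ ⟨_, ⟨n, hn, rfl⟩, rfl⟩
    obtain ⟨m, rfl⟩ : ∃ m, n = m + 1 := ⟨n - 1, by omega⟩
    exact ⟨m, by omega, (hσ m).symm⟩
  · rintro N _ ⟨n, hn, rfl⟩
    exact ⟨_, ⟨n + 1, by omega, rfl⟩, hσ n⟩

theorem isCompact_alphaSet [T2Space X] (hK : IsCompact K) (h : ∀ n : ℕ, σ (-(n : ℤ)) ∈ K) :
    IsCompact (alphaSet σ) :=
  hK.of_isClosed_subset (isClosed_iInter fun _ => isClosed_closure) (alphaSet_subset hK h)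

theorem eventually_mem_of_alphaSet [T2Space X] (hK : IsCompact K)
    (h : ∀ n : ℕ, σ (-(n : ℤ)) ∈ K) {G : Set X} (hG : ∀ y ∈ alphaSet σ, G ∈ 𝓝 y) :
    ∃ N : ℕ, ∀ n : ℕ, N < n → σ (-(n : ℤ)) ∈ G := by
  obtain ⟨N, hN⟩ := exists_subset_of_iInter_closure hK (antitone_alpha_tail σ)
    (alpha_tail_subset h) hG
  exact ⟨N, fun n hn => hN ⟨n, hn, rfl⟩⟩

theorem frequently_mem_of_mem_alphaSet {y : X} (hy : y ∈ alphaSet σ) {G : Set X}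
    (hG : G ∈ 𝓝 y) (N : ℕ) : ∃ n : ℕ, N < n ∧ σ (-(n : ℤ)) ∈ G := by
  obtain ⟨_, hz, n, hn, rfl⟩ := mem_closure_iff_nhds.1 (mem_iInter.1 hy N) G hG
  exact ⟨n, hn, hz⟩

theorem omegaSet_iterate (f : X → X) (x : X) (k : ℕ) : omegaSet f (f^[k] x) = omegaSet f x := by
  have key : ∀ N : ℕ, {y | ∃ n : ℕ, N < n ∧ f^[n] (f^[k] x) = y} =
      {y | ∃ n : ℕ, N + k < n ∧ f^[n] x = y} := by
    intro N
    ext y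
    constructor
    · rintro ⟨n, hn, rfl⟩
      exact ⟨n + k, by omega, Function.iterate_add_apply f n k x⟩
    · rintro ⟨n, hn, rfl⟩
      refine ⟨n - k, by omega, ?_⟩
      rw [← Function.iterate_add_apply]
      congr
      omega
  unfold omegaSet
  simp only [key]
  apply Subset.antisymm
  · exact subset_iInter fun N => (iInter_subset _ N).trans
      (closure_mono (antitone_omega_tail f x (Nat.le_add_right N k)))
  · exact subset_iInter fun N => iInter_subset _ (N + k)

theorem alphaSet_shift_subset (σ : ℤ → X) (k : ℤ) : alphaSet (fun n => σ (k + n)) ⊆ alphaSet σ := by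
  refine subset_iInter fun N => (iInter_subset _ (N + k.natAbs)).trans (closure_mono ?_)
  rintro _ ⟨n, hn, rfl⟩
  refine ⟨(n - k).toNat, by omega, ?_⟩
  congr 1
  omega

end LimitSets

/-! ### Points with a backward chain for a compact relation -/

section BackwardInvariant

open Uniformity

variable {X : Type*}

/-- The largest set in which every point has a predecessor for the relation `R`. -/
def backInv (R : Set (X × X)) : Set X :=
  ⋃₀ {T | ∀ x ∈ T, ∃ y ∈ T, (y, x) ∈ R}

theorem subset_backInv {R : Set (X × X)} {T : Set X} (h : ∀ x ∈ T, ∃ y ∈ T, (y, x) ∈ R) :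
    T ⊆ backInv R := subset_sUnion_of_mem h

theorem exists_mem_backInv {R : Set (X × X)} {x : X} (hx : x ∈ backInv R) :
    ∃ y ∈ backInv R, (y, x) ∈ R := by
  obtain ⟨T, hT, hxT⟩ := hx
  obtain ⟨y, hy, hyx⟩ := hT x hxT
  exact ⟨y, ⟨T, hT, hy⟩, hyx⟩

/-- Adjoining a successor keeps the predecessor property, so maximality absorbs it. This is what
later makes sets of pseudo-orbit points open around images. -/
theorem mem_backInv {R : Set (X × X)} {x y : X} (hy : y ∈ backInv R) (hyx : (y, x) ∈ R) :
    x ∈ backInv R := by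
  have h : insert x (backInv R) ⊆ backInv R := by
    refine subset_backInv ?_
    rintro z (rfl | hz)
    · exact ⟨y, mem_insert_of_mem _ hy, hyx⟩
    · obtain ⟨w, hw, hwz⟩ := exists_mem_backInv hz
      exact ⟨w, mem_insert_of_mem _ hw, hwz⟩
  exact h (mem_insert _ _)

theorem backInv_mono {R Q : Set (X × X)} (h : R ⊆ Q) : backInv R ⊆ backInv Q :=
  subset_backInv fun _ hx =>
    let ⟨y, hy, hyx⟩ := exists_mem_backInv hx
    ⟨y, hy, h hyx⟩

theorem exists_backward_of_mem_backInv {R : Set (X × X)} {x : X} (hx : x ∈ backInv R) :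
    ∃ b : ℕ → X, b 0 = x ∧ ∀ n, (b (n + 1), b n) ∈ R := by
  have hex : ∀ z : backInv R, ∃ y : backInv R, ((y : X), (z : X)) ∈ R := fun z =>
    let ⟨y, hy, hyz⟩ := exists_mem_backInv z.2
    ⟨⟨y, hy⟩, hyz⟩
  choose g hg using hex
  refine ⟨fun n => (g^[n] ⟨x, hx⟩ : backInv R), rfl, fun n => ?_⟩
  simp only [Function.iterate_succ_apply']
  exact hg _

variable [TopologicalSpace X] [T2Space X]

theorem isCompact_backInv {R : Set (X × X)} (hR : IsCompact R) : IsCompact (backInv R) := by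
  have hsub : backInv R ⊆ Prod.snd '' (R ∩ closure (backInv R) ×ˢ univ) := by
    intro x hx
    obtain ⟨y, hy, hyx⟩ := exists_mem_backInv hx
    exact ⟨(y, x), ⟨hyx, subset_closure hy, trivial⟩, rfl⟩
  have hcpt : IsCompact (Prod.snd '' (R ∩ closure (backInv R) ×ˢ univ)) :=
    (hR.inter_right (isClosed_closure.prod isClosed_univ)).image continuous_snd
  have hcl := closure_minimal hsub hcpt.isClosed
  have hclosed : closure (backInv R) ⊆ backInv R := by
    refine subset_backInv fun x hx => ?_
    obtain ⟨⟨y, z⟩, ⟨hyz, hy, -⟩, rfl⟩ := hcl hx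
    exact ⟨y, hy, hyz⟩
  exact hcpt.of_isClosed_subset (isClosed_of_closure_subset hclosed) hsub

/-- Predecessors chosen for different `i` need not agree, but the sets of admissible predecessors
are directed nonempty compacts and so share a point. -/
theorem iInter_backInv_subset {ι : Type*} [Nonempty ι] {R : ι → Set (X × X)}
    (hR : ∀ i, IsCompact (R i)) (hd : Directed (· ⊇ ·) R) :
    ⋂ i, backInv (R i) ⊆ backInv (⋂ i, R i) := by
  refine subset_backInv fun x hx => ?_
  have hclosed : ∀ i, IsCompact (R i ∩ backInv (R i) ×ˢ {x}) := fun i =>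
    (hR i).inter_right ((isCompact_backInv (hR i)).isClosed.prod isClosed_singleton)
  obtain ⟨⟨y, z⟩, hyz⟩ := IsCompact.nonempty_iInter_of_directed_nonempty_isCompact_isClosed
    (fun i => R i ∩ backInv (R i) ×ˢ {x})
    (fun i j => by
      obtain ⟨k, hki, hkj⟩ := hd i j
      exact ⟨k, inter_subset_inter hki (prod_mono (backInv_mono hki) Subset.rfl),
        inter_subset_inter hkj (prod_mono (backInv_mono hkj) Subset.rfl)⟩)
    (fun i => by
      obtain ⟨y, hy, hyx⟩ := exists_mem_backInv (mem_iInter.1 hx i)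
      exact ⟨(y, x), hyx, hy, rfl⟩)
    hclosed (fun i => (hclosed i).isClosed)
  rw [mem_iInter] at hyz
  obtain rfl : z = x := (hyz (Classical.arbitrary ι)).2.2
  exact ⟨y, mem_iInter.2 fun i => (hyz i).2.1, mem_iInter.2 fun i => (hyz i).1⟩

end BackwardInvariant

/-! ### Pseudo-orbits with errors in a closed entourage -/

section Entourages

open Uniformity

variable {X : Type*} {f : X → X} {K : Set X}

/-- The steps inside `K` that follow `f` up to an error in `E`. -/
def stepRel (f : X → X) (K : Set X) (E : Set (X × X)) : Set (X × X) :=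
  {p | p ∈ K ×ˢ K ∧ (f p.1, p.2) ∈ E}

theorem stepRel_mono {E F : Set (X × X)} (h : E ⊆ F) : stepRel f K E ⊆ stepRel f K F :=
  fun _ hp => ⟨hp.1, h hp.2⟩

variable [UniformSpace X]

/-- The closed entourages. -/
abbrev ClosedEntourage (X : Type*) [UniformSpace X] : Type _ :=
  {E : Set (X × X) // E ∈ 𝓤 X ∧ IsClosed E}

instance : Nonempty (ClosedEntourage X) := ⟨⟨univ, Filter.univ_mem, isClosed_univ⟩⟩

theorem directed_closedEntourage : Directed (· ⊇ ·) fun E : ClosedEntourage X => (E : Set (X × X)) :=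
  fun E F => ⟨⟨E ∩ F, Filter.inter_mem E.2.1 F.2.1, E.2.2.inter F.2.2⟩,
    inter_subset_left, inter_subset_right⟩

theorem directed_stepRel (f : X → X) (K : Set X) :
    Directed (· ⊇ ·) fun E : ClosedEntourage X => stepRel f K E :=
  directed_closedEntourage.mono_comp (g := stepRel f K) _ fun _ _ h => stepRel_mono h

variable [T2Space X]

theorem isCompact_stepRel (hK : IsCompact K) (hf : ContinuousOn f K) {E : Set (X × X)}
    (hE : IsClosed E) : IsCompact (stepRel f K E) := by
  have hc : ContinuousOn (fun p : X × X => (f p.1, p.2)) (K ×ˢ K) :=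
    (hf.comp continuousOn_fst fun p hp => hp.1).prodMk continuousOn_snd
  exact (hK.prod hK).of_isClosed_subset
    (hc.preimage_isClosed_of_isClosed (hK.prod hK).isClosed hE) fun _ hp => hp.1

theorem eq_of_mem_iInter_stepRel {x y : X}
    (h : (x, y) ∈ ⋂ E : ClosedEntourage X, stepRel f K E) : x ∈ K ∧ y ∈ K ∧ f x = y := by
  rw [mem_iInter] at h
  have hE := h (Classical.arbitrary _)
  refine ⟨hE.1.1, hE.1.2, eq_of_uniformity_basis uniformity_hasBasis_closed fun {E} hE => ?_⟩
  exact (h ⟨E, hE⟩).2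

theorem exists_backward_of_mem_iInter (hK : IsCompact K) (hf : ContinuousOn f K) {x : X}
    (hx : x ∈ ⋂ E : ClosedEntourage X, backInv (stepRel f K E)) :
    ∃ b : ℕ → X, b 0 = x ∧ (∀ n, b n ∈ K) ∧ ∀ n, f (b (n + 1)) = b n := by
  obtain ⟨b, hb, hR⟩ := exists_backward_of_mem_backInv
    (iInter_backInv_subset (fun E => isCompact_stepRel hK hf E.2.2) (directed_stepRel f K) hx)
  have h := fun n => eq_of_mem_iInter_stepRel (hR n)
  exact ⟨b, hb, fun n => (h n).2.1, fun n => (h n).2.2⟩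

/-- Swapping coordinates turns forward pseudo-orbits into backward chains, so the same compactness
argument applies. -/
theorem iterate_mem_of_mem_iInter (hK : IsCompact K) (hf : ContinuousOn f K) {x : X}
    (hx : x ∈ ⋂ E : ClosedEntourage X, backInv (Prod.swap '' stepRel f K E)) (n : ℕ) :
    f^[n] x ∈ K := by
  have hx' := iInter_backInv_subset
    (fun E : ClosedEntourage X => (isCompact_stepRel hK hf E.2.2).image continuous_swap)
    ((directed_stepRel f K).mono_comp (g := (Prod.swap '' ·)) _ fun _ _ h => image_mono h) hx
  obtain ⟨b, rfl, hR⟩ := exists_backward_of_mem_backInv hx'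
  have h : ∀ n, b n ∈ K ∧ b (n + 1) ∈ K ∧ f (b n) = b (n + 1) := fun n =>
    eq_of_mem_iInter_stepRel <| mem_iInter.2 fun E => by
      obtain ⟨p, hp, hpe⟩ := mem_iInter.1 (hR n) E
      obtain rfl : p = (b n, b (n + 1)) := by rw [← Prod.swap_swap p, hpe]; rfl
      exact hp
  have hiter : ∀ n, f^[n] (b 0) = b n := by
    intro n
    induction n with
    | zero => rfl
    | succ k ih => rw [Function.iterate_succ_apply', ih, (h k).2.2]
  exact hiter n ▸ (h n).1

/-- An invariant set that contains all backward orbits in some compact neighbourhood has an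
attracting neighbourhood. -/
theorem exists_isAttractingNbhd {D V A : Set X} (hV : IsCompact V) (hVD : V ⊆ D)
    (hf : ContinuousOn f V) (hA : f '' A = A) (hAV : A ⊆ interior V)
    (hback : ∀ b : ℕ → X, (∀ n, b n ∈ V) → (∀ n, f (b (n + 1)) = b n) → b 0 ∈ A) :
    ∃ W ⊆ V, IsAttractingNbhd f D W A := by
  have hcpt : ∀ E : ClosedEntourage X, IsCompact (backInv (stepRel f V E)) := fun E =>
    isCompact_backInv (isCompact_stepRel hV hf E.2.2)
  have hmaps : MapsTo f A A := mapsTo_iff_image_subset.2 hA.subset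
  have hsubV : ∀ E, backInv (stepRel f V E) ⊆ V := fun E x hx =>
    let ⟨_, _, h⟩ := exists_mem_backInv hx
    h.1.2
  obtain ⟨O, hO, hOV⟩ := continuousOn_iff'.1 hf (interior V) isOpen_interior
  -- As the error shrinks, only endpoints of true backward orbits in `V` survive. These lie in `A`,
  -- which `f` maps into `interior V`, so some fixed error already suffices.
  obtain ⟨E, hE⟩ := exists_subset_nhds_of_isCompact (U := O)
    (V := fun E : ClosedEntourage X => backInv (stepRel f V E))
    ((directed_stepRel f V).mono_comp (g := backInv) _ fun _ _ h => backInv_mono h) hcpt (by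
      intro x hx
      obtain ⟨b, rfl, hbV, hb⟩ := exists_backward_of_mem_iInter hV hf hx
      have hxA := hback b hbV hb
      refine hO.mem_nhds (hOV.subset ⟨hAV (hmaps hxA), hbV 0⟩).1)
  set W := backInv (stepRel f V E)
  have hWV : W ⊆ V := hsubV E
  have hWint : ∀ x ∈ W, f x ∈ interior V := fun x hx => (hOV.symm.subset ⟨hE hx, hWV hx⟩).1
  have hWW : f '' W ⊆ interior W := by
    rintro _ ⟨x, hx, rfl⟩
    rw [mem_interior_iff_mem_nhds]
    -- Any point of `V` within error `E` of `f x` has `x` as a pseudo-predecessor, hence belongs to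
    -- `W`.
    filter_upwards [isOpen_interior.mem_nhds (hWint x hx), UniformSpace.ball_mem_nhds (f x) E.2.1]
      with y hy hyE
    exact mem_backInv hx ⟨⟨hWV hx, interior_subset hy⟩, hyE⟩
  have hAW : A ⊆ W := by
    refine subset_backInv fun x hx => ?_
    obtain ⟨y, hy, rfl⟩ := hA.symm.subset hx
    exact ⟨y, hy, ⟨interior_subset (hAV hy), interior_subset (hAV hx)⟩, refl_mem_uniformity E.2.1⟩
  refine ⟨W, hWV, hcpt E, hWV.trans hVD, ?_, hWW, ?_⟩
  · exact hA.symm.subset.trans ((image_mono hAW).trans hWW)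
  · rw [← inv_eq_iInter_image (hcpt E) (hf.mono hWV) (hWW.trans interior_subset)]
    refine (subset_inv_of_image_eq hA hAW).antisymm ?_
    rintro x ⟨σ, hσ⟩
    have := hback (fun n => σ (-(n : ℤ))) (fun n => hWV (hσ.2 _).1) hσ.backward
    simpa [hσ.1] using this

/-- Every isolated invariant set has an isolating block: an isolating neighbourhood `N` with
`f⁻¹(N) ∩ N ∩ f(N) ⊆ Int N`. -/
theorem exists_isolating_block (hK : IsCompact K) (hf : ContinuousOn f K)
    (hiso : Inv f K ⊆ interior K) :
    ∃ N ⊆ K, IsCompact N ∧ Inv f N = Inv f K ∧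
      ∀ y ∈ N, f y ∈ N → f (f y) ∈ N → f y ∈ interior N := by
  -- Points with both a backward and a forward pseudo-orbit in `K`; the intersection over all `E`
  -- consists of points with a true solution.
  let B : ClosedEntourage X → Set X := fun E =>
    backInv (stepRel f K E) ∩ backInv (Prod.swap '' stepRel f K E)
  have hcpt : ∀ E, IsCompact (B E) := fun E =>
    (isCompact_backInv (isCompact_stepRel hK hf E.2.2)).inter
      (isCompact_backInv ((isCompact_stepRel hK hf E.2.2).image continuous_swap))
  obtain ⟨E, hE⟩ := exists_subset_nhds_of_isCompact (U := interior K) (V := B)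
    ((directed_stepRel f K).mono_comp
      (g := fun R => backInv R ∩ backInv (Prod.swap '' R)) _
      fun _ _ h => inter_subset_inter (backInv_mono h) (backInv_mono (image_mono h))) hcpt (by
      intro x hx
      rw [mem_iInter] at hx
      obtain ⟨b, rfl, hbK, hb⟩ := exists_backward_of_mem_iInter hK hf
        (mem_iInter.2 fun E => (hx E).1)
      obtain ⟨σ, hσ, -⟩ := exists_isSolution_of_backward hbK hb
        (iterate_mem_of_mem_iInter hK hf (mem_iInter.2 fun E => (hx E).2))
      exact isOpen_interior.mem_nhds (hiso ⟨σ, hσ⟩))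
  have hBK : B E ⊆ K := hE.trans interior_subset
  refine ⟨B E, hBK, hcpt E, (inv_mono hBK).antisymm ?_, ?_⟩
  · refine subset_inv_of_image_eq image_inv (subset_inter ?_ ?_)
    · refine subset_backInv fun x hx => ?_
      obtain ⟨y, hy, rfl⟩ := image_inv.symm.subset hx
      exact ⟨y, hy, ⟨inv_subset hy, inv_subset hx⟩, refl_mem_uniformity E.2.1⟩
    · refine subset_backInv fun x hx => ?_
      have hfx : f x ∈ Inv f K := image_inv.subset ⟨x, hx, rfl⟩
      exact ⟨f x, hfx, (x, f x), ⟨⟨inv_subset hx, inv_subset hfx⟩, refl_mem_uniformity E.2.1⟩, rfl⟩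
  · intro y hy hfy hffy
    have hfyK := hE hfy
    rw [mem_interior_iff_mem_nhds]
    have hcont : ContinuousAt f (f y) := hf.continuousAt (mem_interior_iff_mem_nhds.1 hfyK)
    -- A point `z` near `f y` inherits its past from `y` and its future from `f (f y)`, each at the
    -- cost of one error in `E`.
    filter_upwards [isOpen_interior.mem_nhds hfyK, UniformSpace.ball_mem_nhds (f y) E.2.1,
      hcont (mem_nhds_right (f (f y)) E.2.1)] with z hzK hz₁ hz₂
    exact ⟨mem_backInv hy.1 ⟨⟨hBK hy, interior_subset hzK⟩, hz₁⟩,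
      mem_backInv hffy.2 ⟨(z, f (f y)), ⟨⟨interior_subset hzK, hBK hffy⟩, hz₂⟩, rfl⟩⟩

end Entourages

/-! ### Existence of filtration pairs -/

section FiltrationPairs

variable {X : Type*} [UniformSpace X] [T2Space X]

theorem exists_regular_isolating_block {K : Set X} {f : X → X} (hK : IsCompact K)
    (hf : ContinuousOn f K) (hiso : Inv f K ⊆ interior K) :
    ∃ N ⊆ K, IsCompact N ∧ N = closure (interior N) ∧ Inv f N = Inv f K ∧
      Inv f K ⊆ interior N ∧ ∀ y ∈ N, f y ∈ N → f (f y) ∈ N → f y ∈ interior N := by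
  obtain ⟨B, hBK, hB, hBinv, hblock⟩ := exists_isolating_block hK hf hiso
  have hNB : closure (interior B) ⊆ B := closure_minimal interior_subset hB.isClosed
  have hint : interior B ⊆ interior (closure (interior B)) :=
    interior_maximal subset_closure isOpen_interior
  have hinv : Inv f K ⊆ interior B := by
    rw [← hBinv]
    intro x hx
    obtain ⟨y, hy, rfl⟩ := image_inv.symm.subset hx
    exact hblock y (inv_subset hy) (inv_subset hx) (inv_subset (image_inv.subset ⟨_, hx, rfl⟩))
  refine ⟨closure (interior B), hNB.trans hBK, hB.of_isClosed_subset isClosed_closure hNB, ?_,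
    ?_, hinv.trans hint, fun y hy h₁ h₂ => hint (hblock y (hNB hy) (hNB h₁) (hNB h₂))⟩
  · exact (closure_mono hint).antisymm (closure_minimal interior_subset isClosed_closure)
  · refine (inv_mono (hNB.trans hBK)).antisymm ?_
    exact subset_inv_of_image_eq image_inv (hinv.trans subset_closure)

theorem exists_isFiltrationPair [LocallyCompactSpace X] {U S : Set X} (hU : IsOpen U) {f : X → X}
    (hf : ContinuousOn f U) (hS : IsIsolatedInvariant f U S) :
    ∃ N L : Set X, IsFiltrationPair f U S N L := by
  obtain ⟨K, ⟨hK, hKU, hiso⟩, rfl⟩ := hS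
  obtain ⟨N, hNK, hN, hreg, hinv, hSN, hblock⟩ :=
    exists_regular_isolating_block hK (hf.mono hKU) hiso
  have hNU := hNK.trans hKU
  have hSc : IsClosed (Inv f K) := (isCompact_inv hK (hf.mono hKU)).isClosed
  have hSimg : ∀ x ∈ Inv f K, f x ∈ Inv f K := fun x hx => image_inv.subset ⟨x, hx, rfl⟩
  have hcont : ∀ x ∈ U, ContinuousAt f x := fun x hx => hf.continuousAt (hU.mem_nhds hx)
  have hexc : IsCompact (exitSet f N) :=
    hN.of_isClosed_subset ((hf.mono hNU).preimage_isClosed_of_isClosed hN.isClosed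
      isOpen_interior.isClosed_compl) fun _ hx => hx.1
  -- The second clause says that a point whose image stays in `N` leaves `N` at the next step. The
  -- block property gives this for exit points, and it persists nearby.
  let H : Set X := {y | y ∉ Inv f K ∧ (f y ∈ N → f (f y) ∉ N)}
  have hH : ∀ x ∈ exitSet f N, x ∈ interior H := by
    intro x hx
    rw [mem_interior_iff_mem_nhds]
    refine Filter.inter_mem (hSc.isOpen_compl.mem_nhds fun h => hx.2 (hSN (hSimg x h))) ?_
    by_cases hfx : f x ∈ N
    · have h := ((hcont (f x) (hNU hfx)).comp (hcont x (hNU hx.1))).preimage_mem_nhds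
        (hN.isClosed.isOpen_compl.mem_nhds fun h => hx.2 (hblock x hx.1 hfx h))
      exact Filter.mem_of_superset h fun y hy _ => hy
    · have h := (hcont x (hNU hx.1)).preimage_mem_nhds (hN.isClosed.isOpen_compl.mem_nhds hfx)
      exact Filter.mem_of_superset h fun y hy hy' => absurd hy' hy
  obtain ⟨C, hC, hexC, hCH⟩ := exists_compact_between hexc isOpen_interior hH
  set L := closure (interior C ∩ interior N)
  have hLN : L ⊆ N := closure_minimal (inter_subset_right.trans interior_subset) hN.isClosed
  have hLC : L ⊆ C := closure_minimal (inter_subset_left.trans interior_subset) hC.isClosed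
  have hLH : L ⊆ H := hLC.trans (hCH.trans interior_subset)
  have hOL : interior C ∩ N ⊆ L := by
    rw [hreg]
    exact isOpen_interior.inter_closure
  have hSL : Inv f K ⊆ interior (closure (N \ L)) := by
    refine Subset.trans ?_ (interior_maximal ((sdiff_subset_sdiff_left interior_subset).trans
      subset_closure) (isOpen_interior.sdiff (isClosed_closure (s := interior C ∩ interior N))))
    exact fun x hx => ⟨hSN hx, fun h => (hLH h).1 hx⟩
  have hclN : closure (N \ L) ⊆ N := closure_minimal sdiff_subset hN.isClosed
  have hinv' : Inv f (closure (N \ L)) = Inv f K :=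
    ((inv_mono hclN).trans hinv.subset).antisymm
      (subset_inv_of_image_eq image_inv (hSL.trans interior_subset))
  refine ⟨N, L, hN, hN.of_isClosed_subset isClosed_closure hLN, hLN,
    hNU.trans hU.interior_eq.symm.subset, hreg, ?_, ?_, hinv'.symm,
    ⟨interior C, isOpen_interior, hexC, hOL⟩, ?_⟩
  · refine Subset.antisymm (closure_mono ?_) (closure_minimal interior_subset isClosed_closure)
    exact interior_maximal subset_closure (isOpen_interior.inter isOpen_interior)
  · exact ⟨hN.of_isClosed_subset isClosed_closure hclN, hclN.trans hNU, hinv'.subset.trans hSL⟩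
  · rw [eq_empty_iff_forall_notMem]
    rintro _ ⟨⟨y, hy, rfl⟩, hfy⟩
    -- If `f y` were in `closure (N \ L)`, it would be an exit point, and near exit points all of
    -- `N` lies in `L`.
    have hex : f y ∈ exitSet f N :=
      ⟨hclN hfy, fun h => (hLH hy).2 (hclN hfy) (interior_subset h)⟩
    obtain ⟨z, hzC, hzN, hzL⟩ := mem_closure_iff.1 hfy _ isOpen_interior (hexC hex)
    exact hzL (hOL ⟨hzC, hzN⟩)

end FiltrationPairs

/-! ### Morse sets -/

section Morse

variable {X : Type*} [TopologicalSpace X] [T2Space X] {f : X → X} {D S : Set X}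

theorem IsIsolatedInvariant.isCompact (hS : IsIsolatedInvariant f D S) (hf : ContinuousOn f D) :
    IsCompact S := by
  obtain ⟨K, hK, rfl⟩ := hS
  exact isCompact_inv hK.1 (hf.mono hK.2.1)

omit [T2Space X] in
theorem IsIsolatedInvariant.subset (hS : IsIsolatedInvariant f D S) : S ⊆ D := by
  obtain ⟨K, hK, rfl⟩ := hS
  exact inv_subset.trans hK.2.1

omit [T2Space X] in
theorem IsIsolatedInvariant.image_eq (hS : IsIsolatedInvariant f D S) : f '' S = S := by
  obtain ⟨K, hK, rfl⟩ := hS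
  exact image_inv

omit [TopologicalSpace X] [T2Space X] in
theorem iterate_mem_of_image_eq {C : Set X} (hC : f '' C = C) {x : X} (hx : x ∈ C) (n : ℕ) :
    f^[n] x ∈ C := (mapsTo_iff_image_subset.2 hC.subset).iterate n hx

omit [T2Space X] in
theorem continuousAt_iterate (hD : IsOpen D) (hf : ContinuousOn f D) {x : X}
    (hx : ∀ n, f^[n] x ∈ D) (n : ℕ) : ContinuousAt f^[n] x := by
  induction n with
  | zero => exact continuousAt_id
  | succ k ih =>
    rw [Function.iterate_succ']
    exact (hf.continuousAt (hD.mem_nhds (hx k))).comp ih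

omit [T2Space X] in
theorem IsSolution.omegaSet_eq {A : Set X} {x : X} {σ : ℤ → X} (h : IsSolution f A x σ) (k : ℤ) :
    omegaSet f (σ k) = omegaSet f x := by
  rcases le_total 0 k with hk | hk
  · obtain ⟨n, rfl⟩ := Int.eq_ofNat_of_zero_le hk
    rw [← h.iterate n, omegaSet_iterate]
  · obtain ⟨n, hn⟩ := Int.eq_ofNat_of_zero_le (neg_nonneg.2 hk)
    have := h.iterate_add k n
    rw [← hn, add_neg_cancel, h.1] at this
    rw [← this, omegaSet_iterate]

section InvariantLimits

variable {C : Set X} {x : X} {σ : ℤ → X}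

theorem IsSolution.omegaSet_subset (h : IsSolution f C x σ) (hC : IsCompact C) :
    omegaSet f x ⊆ C :=
  ConleyMorse.omegaSet_subset hC fun n => h.iterate n ▸ (h.2 n).1

theorem IsSolution.omegaSet_nonempty (h : IsSolution f C x σ) (hC : IsCompact C) :
    (omegaSet f x).Nonempty :=
  ConleyMorse.omegaSet_nonempty hC fun n => h.iterate n ▸ (h.2 n).1

theorem IsSolution.alphaSet_subset (h : IsSolution f C x σ) (hC : IsCompact C) :
    alphaSet σ ⊆ C := ConleyMorse.alphaSet_subset hC fun _ => (h.2 _).1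

theorem IsSolution.alphaSet_nonempty (h : IsSolution f C x σ) (hC : IsCompact C) :
    (alphaSet σ).Nonempty := ConleyMorse.alphaSet_nonempty hC fun _ => (h.2 _).1

end InvariantLimits

variable {P : Type*} [PartialOrder P] {M : P → Set X}

omit [T2Space X] in
theorem IsMorseDecomposition.index_eq (hM : IsMorseDecomposition f D S M) {p q : P} {T : Set X}
    (hT : T.Nonempty) (hp : T ⊆ M p) (hq : T ⊆ M q) : p = q := by
  by_contra h
  obtain ⟨x, hx⟩ := hT
  exact disjoint_left.1 (hM.disjoint p q h) (hp hx) (hq hx)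

/-- The points of a compact invariant set whose forward orbit stays near a maximal Morse set are
themselves near that Morse set; this persists for finite orbit segments of nearby points. -/
theorem IsMorseDecomposition.exists_backward_trapping (hM : IsMorseDecomposition f D S M)
    (hS : IsIsolatedInvariant f D S) (hD : IsOpen D) (hf : ContinuousOn f D) {C : Set X}
    (hC : IsCompact C) (hCS : C ⊆ S) (hfC : f '' C = C) {q : P}
    (hmax : ∀ p, q < p → ¬ (M p ∩ C).Nonempty) {V : Set X} (hV : IsIsolatingNbhd f D V)
    (hqV : M q = Inv f V) :
    ∃ n : ℕ, ∀ y ∈ C, ∀ᶠ z in 𝓝 y, (∀ i ≤ n, f^[i + 1] z ∈ V) → z ∈ V := by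
  have hCD : C ⊆ D := hCS.trans hS.subset
  have hiter : ∀ n, ContinuousOn f^[n] C := fun n =>
    (hf.mono hCD).iterate (mapsTo_iff_image_subset.2 hfC.subset) n
  let T : ℕ → Set X := fun n => C ∩ ⋂ i ∈ Iic n, C ∩ f^[i + 1] ⁻¹' V
  have hTcpt : ∀ n, IsCompact (T n) := fun n => hC.inter_right
    (isClosed_biInter fun i _ => (hiter (i + 1)).preimage_isClosed_of_isClosed hC.isClosed
      hV.1.isClosed)
  have hTmem : ∀ {n y}, y ∈ C → (y ∈ T n ↔ ∀ i ≤ n, f^[i + 1] y ∈ V) := by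
    intro n y hy
    simp [T, hy]
  -- A point in every `T n` has its ω-limit set in `M q`. A solution in `C` through it must stay in
  -- `M q`, since otherwise its α-limit set would make a Morse set of larger index meet `C`.
  obtain ⟨n, hn⟩ := exists_subset_nhds_of_isCompact (V := T) (U := interior V)
    (directed_of_isDirected_le fun m n h => inter_subset_inter_right _
      (biInter_subset_biInter_left (Iic_subset_Iic.2 h))) hTcpt (by
      intro x hx
      rw [mem_iInter] at hx
      have hxC : x ∈ C := (hx 0).1
      have hxV : ∀ i, f^[i] (f x) ∈ V := fun i => (hTmem hxC).1 (hx i) i le_rfl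
      obtain ⟨σ, hσ⟩ := subset_inv_of_image_eq hfC Subset.rfl hxC
      have hω : omegaSet f x ⊆ M q := by
        have h1 : omegaSet f x = omegaSet f (f x) := (omegaSet_iterate f x 1).symm
        rw [h1, hqV]
        exact subset_inv_of_image_eq (image_omegaSet hV.1 (hf.mono hV.2.1) hxV)
          (omegaSet_subset hV.1 hxV)
      refine isOpen_interior.mem_nhds (hV.2.2 (hqV ▸ ?_))
      rcases hM.solution x (hCS hxC) σ (hσ.mono hCS) with ⟨p, hp⟩ | ⟨p, r, hpr, hp, hr⟩
      · have hσp : IsSolution f (M p) x σ := ⟨hσ.1, fun n => ⟨hp n, (hσ.2 n).2⟩⟩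
        obtain rfl := hM.index_eq (hσ.omegaSet_nonempty hC)
          (hσp.omegaSet_subset ((hM.isolated p).isCompact hf)) hω
        exact hσp.mem
      · obtain rfl := hM.index_eq (hσ.omegaSet_nonempty hC) hp hω
        obtain ⟨z, hz⟩ := hσ.alphaSet_nonempty hC
        exact absurd ⟨z, hr hz, hσ.alphaSet_subset hC hz⟩ (hmax r hpr))
  refine ⟨n, fun y hy => ?_⟩
  by_cases hyT : y ∈ T n
  · filter_upwards [isOpen_interior.mem_nhds (hn hyT)] with z hz _
    exact interior_subset hz
  -- Some iterate of `y` is outside the closed set `V`; the same holds near `y`, and the implication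
  -- is vacuous there.
  · rw [hTmem hy] at hyT
    push Not at hyT
    obtain ⟨i, hi, hiV⟩ := hyT
    have hc := continuousAt_iterate hD hf (fun n => hCD (iterate_mem_of_image_eq hfC hy n)) (i + 1)
    filter_upwards [hc.preimage_mem_nhds (hV.1.isClosed.isOpen_compl.mem_nhds hiV)] with z hz h
    exact absurd (h i hi) hz

omit [TopologicalSpace X] [T2Space X] in
-- A window of consecutive iterates in `V` slides backwards along the orbit one step at a time.
theorem forall_backward_mem {V : Set X} {n : ℕ} {b : ℕ → X} (hb : ∀ k, f (b (k + 1)) = b k)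
    (h : ∀ k, (∀ i ≤ n, f^[i + 1] (b k) ∈ V) → b k ∈ V) (h0 : ∀ i ≤ n, f^[i] (b 0) ∈ V) (k : ℕ) :
    b k ∈ V := by
  suffices H : ∀ k, ∀ i ≤ n, f^[i] (b k) ∈ V from H k 0 n.zero_le
  intro k
  induction k with
  | zero => exact h0
  | succ k ih =>
    have hs : ∀ i ≤ n, f^[i + 1] (b (k + 1)) ∈ V := fun i hi => by
      rw [Function.iterate_succ_apply, hb]; exact ih i hi
    rintro (_ | i) hi
    · exact h (k + 1) hs
    · exact hs i (by omega)

omit [T2Space X] in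
theorem IsMorseDecomposition.eventually_iterate_mem (hM : IsMorseDecomposition f D S M)
    (hD : IsOpen D) (hf : ContinuousOn f D) {q : P} {V : Set X} (hqV : M q ⊆ interior V) {y : X}
    (hy : y ∈ M q) (n : ℕ) : ∀ᶠ z in 𝓝 y, ∀ i ≤ n, f^[i] z ∈ V := by
  have hmem := fun i => iterate_mem_of_image_eq (hM.isolated q).image_eq hy i
  refine (Filter.eventually_all_finite (finite_Iic n)).2 fun i _ => ?_
  exact (continuousAt_iterate hD hf (fun i => (hM.isolated q).subset (hmem i)) i).preimage_mem_nhds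
    (mem_interior_iff_mem_nhds.1 (hqV (hmem i)))

/-- The `α`-limit set of a backward orbit that stays in a neighbourhood of `S` isolating `S` is
contained in a single Morse set, although the orbit need not be contained in `S`. -/
theorem IsMorseDecomposition.exists_alphaSet_subset [Finite P]
    (hM : IsMorseDecomposition f D S M)
    (hS : IsIsolatedInvariant f D S) (hD : IsOpen D) (hf : ContinuousOn f D) {K : Set X}
    (hK : IsCompact K) (hKD : K ⊆ D) (hKS : Inv f K = S) {σ : ℤ → X}
    (hσK : ∀ n : ℕ, σ (-(n : ℤ)) ∈ K)
    (hσ : ∀ n : ℕ, f (σ (-((n + 1 : ℕ) : ℤ))) = σ (-(n : ℤ))) : ∃ q, alphaSet σ ⊆ M q := by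
  have hC := isCompact_alphaSet hK hσK
  have hfC := image_alphaSet hK (hf.mono hKD) hσK hσ
  have hCS : alphaSet σ ⊆ S := hKS ▸ subset_inv_of_image_eq hfC (alphaSet_subset hK hσK)
  have hne : {p | (M p ∩ alphaSet σ).Nonempty}.Nonempty := by
    -- The Morse axiom may fail to apply to `σ`, but it applies to solutions inside its α-limit set,
    -- which is an invariant subset of `S`.
    obtain ⟨x, hx⟩ := alphaSet_nonempty hK hσK
    obtain ⟨τ, hτ⟩ := subset_inv_of_image_eq hfC Subset.rfl hx
    rcases hM.solution x (hCS hx) τ (hτ.mono hCS) with ⟨p, hp⟩ | ⟨p, -, -, hp, -⟩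
    · exact ⟨p, x, hτ.1 ▸ hp 0, hx⟩
    · obtain ⟨z, hz⟩ := hτ.omegaSet_nonempty hC
      exact ⟨p, z, hp hz, hτ.omegaSet_subset hC hz⟩
  obtain ⟨q, ⟨y, hyq, hyα⟩, hqmax⟩ := (toFinite {p | (M p ∩ alphaSet σ).Nonempty}).exists_maximal hne
  obtain ⟨V, hV, hqV⟩ := hM.isolated q
  obtain ⟨n, hn⟩ := hM.exists_backward_trapping hS hD hf hC hCS hfC
    (fun p hqp h => (hqmax h hqp.le).not_gt hqp) hV hqV
  obtain ⟨N, hN⟩ := eventually_mem_of_alphaSet hK hσK hn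
  obtain ⟨m, hm, hmV⟩ := frequently_mem_of_mem_alphaSet hyα
    (hM.eventually_iterate_mem hD hf (hqV ▸ hV.2.2) hyq n) N
  -- Far enough back the trapping condition always holds, and the orbit returns arbitrarily near
  -- `y`; one such return starts the window in `V`.
  have htail : ∀ k : ℕ, σ (-((m + k : ℕ) : ℤ)) ∈ V :=
    forall_backward_mem (f := f) (fun k => hσ (m + k)) (fun k => hN (m + k) (by omega)) hmV
  refine ⟨q, hqV ▸ subset_inv_of_image_eq hfC ?_⟩
  refine (iInter_subset _ m).trans (closure_minimal ?_ hV.1.isClosed)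
  rintro _ ⟨k, hk, rfl⟩
  obtain ⟨j, rfl⟩ := Nat.exists_eq_add_of_lt hk
  exact htail (j + 1)

omit [T2Space X] [PartialOrder P] in
theorem morseSet_mono {I J : Set P} (h : I ⊆ J) : morseSet f S M I ⊆ morseSet f S M J :=
  union_subset_union (biUnion_subset_biUnion_left h)
    ((biUnion_mono h) fun _ _ => biUnion_subset_biUnion_left h)

omit [T2Space X] [PartialOrder P] in
-- Connecting orbits exclude points of the two end Morse sets, but such points belong to `M_I`
-- anyway, so the limit conditions suffice.
theorem mem_morseSet {I : Set P} {x : X} {σ : ℤ → X} (hσ : IsSolution f S x σ) {q r : P}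
    (hq : q ∈ I) (hr : r ∈ I) (hα : alphaSet σ ⊆ M q) (hω : omegaSet f x ⊆ M r) :
    x ∈ morseSet f S M I := by
  by_cases h : x ∈ M q ∪ M r
  · rcases h with h | h
    · exact Or.inl (mem_biUnion hq h)
    · exact Or.inl (mem_biUnion hr h)
  · exact Or.inr (mem_biUnion hq (mem_biUnion hr ⟨⟨hσ.mem, h⟩, σ, hσ, hα, hω⟩))

theorem IsMorseDecomposition.exists_isSolution (hM : IsMorseDecomposition f D S M)
    (hf : ContinuousOn f D) {I : Set P} {x : X} (hx : x ∈ morseSet f S M I) :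
    ∃ σ, IsSolution f (morseSet f S M I) x σ ∧
      ∃ q ∈ I, ∃ r ∈ I, alphaSet σ ⊆ M q ∧ omegaSet f x ⊆ M r := by
  rcases hx with hx | hx
  · simp only [mem_iUnion, exists_prop] at hx
    obtain ⟨p, hp, hx⟩ := hx
    obtain ⟨σ, hσ⟩ := subset_inv_of_image_eq (hM.isolated p).image_eq Subset.rfl hx
    have hc := (hM.isolated p).isCompact hf
    exact ⟨σ, hσ.mono fun y hy => Or.inl (mem_biUnion hp hy), p, hp, p, hp,
      hσ.alphaSet_subset hc, hσ.omegaSet_subset hc⟩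
  · simp only [mem_iUnion, exists_prop] at hx
    obtain ⟨q, hq, r, hr, -, σ, hσ, hα, hω⟩ := hx
    refine ⟨σ, ⟨hσ.1, fun n => ⟨?_, (hσ.2 n).2⟩⟩, q, hq, r, hr, hα, hω⟩
    exact mem_morseSet (hσ.shift n) hq hr ((alphaSet_shift_subset σ n).trans hα)
      ((hσ.omegaSet_eq n).subset.trans hω)

omit [T2Space X] in
theorem IsMorseDecomposition.morseSet_subset (hM : IsMorseDecomposition f D S M) {I : Set P} :
    morseSet f S M I ⊆ S :=
  union_subset (iUnion₂_subset fun p _ => hM.subset p)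
    (iUnion₂_subset fun _ _ => iUnion₂_subset fun _ _ _ hx => hx.1.1)

theorem IsMorseDecomposition.inv_morseSet (hM : IsMorseDecomposition f D S M)
    (hf : ContinuousOn f D) (I : Set P) :
    Inv f (morseSet f S M I) = morseSet f S M I :=
  inv_subset.antisymm fun _ hx =>
    let ⟨σ, hσ, _⟩ := hM.exists_isSolution hf hx
    ⟨σ, hσ⟩

theorem IsMorseDecomposition.image_morseSet (hM : IsMorseDecomposition f D S M)
    (hf : ContinuousOn f D) (I : Set P) : f '' morseSet f S M I = morseSet f S M I := by
  rw [← hM.inv_morseSet hf I, image_inv]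

theorem IsMorseDecomposition.mem_of_omegaSet_subset (hM : IsMorseDecomposition f D S M)
    (hS : IsIsolatedInvariant f D S) (hf : ContinuousOn f D) {I : Set P} {x : X} {p : P}
    (hx : x ∈ morseSet f S M I) (hp : omegaSet f x ⊆ M p) : p ∈ I := by
  obtain ⟨σ, hσ, -, -, r, hr, -, hω⟩ := hM.exists_isSolution hf hx
  have hne := (hσ.mono hM.morseSet_subset).omegaSet_nonempty (hS.isCompact hf)
  exact hM.index_eq hne hω hp ▸ hr

/-- Pick `q ∉ J` maximal with `M q` meeting the closure; indices above `q` are outside `J` too, so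
trapping applies. A point of `M_J` near `M q` then has a backward orbit with α-limit set in `M q`,
although that limit set lies in a Morse set indexed by `J`. -/
theorem IsMorseDecomposition.disjoint_closure_morseSet [Finite P]
    (hM : IsMorseDecomposition f D S M) (hS : IsIsolatedInvariant f D S) (hD : IsOpen D)
    (hf : ContinuousOn f D) {J : Set P} (hJ : IsLowerSet J) {p : P} (hp : p ∉ J) :
    Disjoint (M p) (closure (morseSet f S M J)) := by
  by_contra hne
  rw [not_disjoint_iff_nonempty_inter] at hne
  have hSc := hS.isCompact hf
  have hCS : closure (morseSet f S M J) ⊆ S := closure_minimal hM.morseSet_subset hSc.isClosed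
  have hC := hSc.of_isClosed_subset isClosed_closure hCS
  have hfC := image_closure_eq hSc (hf.mono hS.subset) hM.morseSet_subset (hM.image_morseSet hf J)
  obtain ⟨q, ⟨hqJ, y, hyq, hyC⟩, hqmax⟩ :=
    (toFinite {p | p ∉ J ∧ (M p ∩ closure (morseSet f S M J)).Nonempty}).exists_maximal
      ⟨p, hp, hne⟩
  obtain ⟨V, hV, hqV⟩ := hM.isolated q
  obtain ⟨n, hn⟩ := hM.exists_backward_trapping hS hD hf hC hCS hfC
    (fun p hqp h => (hqmax ⟨fun hpJ => hqJ (hJ hqp.le hpJ), h⟩ hqp.le).not_gt hqp) hV hqV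
  obtain ⟨x, hxV, hxJ⟩ := mem_closure_iff_nhds.1 hyC _
    (hM.eventually_iterate_mem hD hf (hqV ▸ hV.2.2) hyq n)
  obtain ⟨σ, hσ, r, hr, -, -, hα, -⟩ := hM.exists_isSolution hf hxJ
  have hσV : ∀ k : ℕ, σ (-(k : ℤ)) ∈ V :=
    forall_backward_mem (f := f) hσ.backward
      (fun k => (hn _ (subset_closure (hσ.2 _).1)).self_of_nhds) (by simpa [hσ.1] using hxV)
  have hαq : alphaSet σ ⊆ M q := hqV ▸ subset_inv_of_image_eq
    (image_alphaSet hV.1 (hf.mono hV.2.1) hσV hσ.backward) (alphaSet_subset hV.1 hσV)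
  exact hqJ (hM.index_eq (alphaSet_nonempty hV.1 hσV) hα hαq ▸ hr)

end Morse

/-! ### Realisation between attracting neighbourhoods -/

section Realisation

variable {X : Type*} [UniformSpace X] [T2Space X] {f : X → X} {D S : Set X}
  {P : Type*} [PartialOrder P] [Finite P] {M : P → Set X}

omit [T2Space X] in
theorem isIsolatedInvariant_of_image_subset {Y : Set X} (hY : IsCompact Y) (hYD : Y ⊆ D)
    (hfY : f '' Y ⊆ interior Y) : IsIsolatedInvariant f D (Inv f Y) :=
  ⟨Y, ⟨hY, hYD, image_inv.symm.subset.trans ((image_mono inv_subset).trans hfY)⟩, rfl⟩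

theorem IsMorseDecomposition.exists_isAttractingNbhd {Y : Set X} (hY : IsCompact Y) (hYD : Y ⊆ D)
    (hfY : f '' Y ⊆ interior Y) (hM : IsMorseDecomposition f D (Inv f Y) M)
    (hD : IsOpen D) (hf : ContinuousOn f D) {J : Set P} (hJ : IsLowerSet J) :
    ∃ W ⊆ Y, IsAttractingNbhd f D W (morseSet f (Inv f Y) M J) := by
  have hS := isIsolatedInvariant_of_image_subset hY hYD hfY
  have hSY : Inv f Y ⊆ interior Y :=
    image_inv.symm.subset.trans ((image_mono inv_subset).trans hfY)
  have hcl : IsCompact (closure (morseSet f (Inv f Y) M J)) :=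
    (hS.isCompact hf).of_isClosed_subset isClosed_closure
      (closure_minimal hM.morseSet_subset (hS.isCompact hf).isClosed)
  have hB : IsCompact (⋃ p ∈ Jᶜ, M p) :=
    (toFinite Jᶜ).isCompact_biUnion fun p _ => (hM.isolated p).isCompact hf
  have hdisj : Disjoint (closure (morseSet f (Inv f Y) M J)) (⋃ p ∈ Jᶜ, M p) :=
    disjoint_iUnion₂_right.2 fun p hp => (hM.disjoint_closure_morseSet hS hD hf hJ hp).symm
  obtain ⟨O₁, O₂, hO₁, hO₂, hAO, hBO, hO⟩ := SeparatedNhds.of_isCompact_isCompact hcl hB hdisj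
  have hV : IsCompact (Y \ O₂) := hY.diff hO₂
  -- Removing `O₂` cuts out every Morse set outside `J`, so a backward orbit in `Y \ O₂` can only
  -- originate from Morse sets in `J`.
  obtain ⟨W, hW, hWatt⟩ := ConleyMorse.exists_isAttractingNbhd (f := f) (D := D) hV
    (sdiff_subset.trans hYD) (hf.mono (sdiff_subset.trans hYD)) (hM.image_morseSet hf J) (by
      refine Subset.trans ?_ (interior_maximal (t := interior Y ∩ O₁) ?_ (isOpen_interior.inter hO₁))
      · exact fun x hx => ⟨hSY (hM.morseSet_subset hx), hAO (subset_closure hx)⟩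
      · exact fun x hx => ⟨interior_subset hx.1, disjoint_left.1 hO hx.2⟩) (by
      intro b hbV hb
      have hmaps : MapsTo f Y Y := mapsTo_iff_image_subset.2 (hfY.trans interior_subset)
      obtain ⟨σ, hσ, hσb⟩ := exists_isSolution_of_backward (fun n => (hbV n).1) hb
        fun n => hmaps.iterate n (hbV 0).1
      rcases hM.solution _ ⟨σ, hσ⟩ σ hσ.to_inv with ⟨p, hp⟩ | ⟨p, q, hpq, hω, hα⟩
      · have hpJ : p ∈ J := by
          by_contra hpJ
          exact (hbV 0).2 (hBO (mem_biUnion hpJ (hσ.1 ▸ hp 0)))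
        exact Or.inl (mem_biUnion hpJ (hσ.1 ▸ hp 0))
      · have hσV : ∀ n : ℕ, σ (-(n : ℤ)) ∈ Y \ O₂ := fun n => hσb n ▸ hbV n
        have hqJ : q ∈ J := by
          by_contra hqJ
          obtain ⟨z, hz⟩ := alphaSet_nonempty hV hσV
          exact (alphaSet_subset hV hσV hz).2 (hBO (mem_biUnion hqJ (hα hz)))
        exact mem_morseSet hσ.to_inv hqJ (hJ hpq.le hqJ) hα hω)
  exact ⟨W, hW.trans sdiff_subset, hWatt⟩

theorem IsAttractingNbhd.inv_eq {U A : Set X} (h : IsAttractingNbhd f D U A)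
    (hf : ContinuousOn f D) : Inv f U = A := by
  rw [h.eq_iInter]
  exact inv_eq_iInter_image h.compact (hf.mono h.subset_domain)
    (h.image_subset.trans interior_subset)

theorem IsAttractingNbhd.inter {U U' A A' : Set X} (h : IsAttractingNbhd f D U A)
    (h' : IsAttractingNbhd f D U' A') (hf : ContinuousOn f D) (hAA' : A ⊆ A') :
    IsAttractingNbhd f D (U ∩ U') A := by
  have himg : f '' (U ∩ U') ⊆ interior (U ∩ U') := by
    rw [interior_inter]
    exact (image_inter_subset f U U').trans (inter_subset_inter h.image_subset h'.image_subset)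
  have hcpt := h.compact.inter h'.compact
  have hsub : U ∩ U' ⊆ D := inter_subset_left.trans h.subset_domain
  have hA : A ⊆ interior (U ∩ U') := by
    rw [interior_inter]
    exact subset_inter h.nbhd (hAA'.trans h'.nbhd)
  refine ⟨hcpt, hsub, hA, himg, ?_⟩
  rw [← inv_eq_iInter_image hcpt (hf.mono hsub) (himg.trans interior_subset)]
  refine Subset.antisymm ?_ ((inv_mono inter_subset_left).trans (h.inv_eq hf).subset)
  exact subset_inv_of_image_eq (by rw [← h.inv_eq hf, image_inv]) (hA.trans interior_subset)

theorem IsMorseDecomposition.isRealisedBetween {Y : Set X} (hY : IsCompact Y) (hYD : Y ⊆ D)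
    (hfY : f '' Y ⊆ interior Y) (hM : IsMorseDecomposition f D (Inv f Y) M)
    (hD : IsOpen D) (hf : ContinuousOn f D) {I : Set P} (hI : I.OrdConnected) :
    IsRealisedBetween f D (Inv f Y) M I Y (morseSet f (Inv f Y) M I) := by
  have hS := isIsolatedInvariant_of_image_subset hY hYD hfY
  have hSc := hS.isCompact hf
  set S := Inv f Y
  set J₁ : Set P := ((lowerClosure I : LowerSet P) : Set P) with hJ₁
  set J₀ : Set P := J₁ \ I with hJ₀
  have hJ₁l : IsLowerSet J₁ := (lowerClosure I).lower
  have hIJ₁ : I ⊆ J₁ := subset_lowerClosure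
  have hJ₀l : IsLowerSet J₀ := by
    rintro q r hrq ⟨hq, hqI⟩
    refine ⟨hJ₁l hrq hq, fun hr => hqI ?_⟩
    obtain ⟨i, hi, hqi⟩ := mem_lowerClosure.1 hq
    -- An element `r ∈ I` below `q`, and one above `q` from the lower closure, would force `q ∈ I`.
    exact hI.out hr hi ⟨hrq, hqi⟩
  have hdisj : Disjoint J₀ I := disjoint_sdiff_left
  have hunion : J₁ = J₀ ∪ I := (sdiff_union_of_subset hIJ₁).symm
  obtain ⟨U₁, hU₁Y, hU₁⟩ := hM.exists_isAttractingNbhd hY hYD hfY hD hf hJ₁l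
  obtain ⟨W, -, hW⟩ := hM.exists_isAttractingNbhd hY hYD hfY hD hf hJ₀l
  -- Intersecting with `U₁` makes the two neighbourhoods nested.
  have hU₀ := hW.inter hU₁ hf (morseSet_mono sdiff_subset)
  set U₀ := W ∩ U₁
  -- the limit set of a point of `M_I` misses `M_{J₀}`
  have hmiss : ∀ x ∈ morseSet f S M I, omegaSet f x ∩ morseSet f S M J₀ = ∅ := by
    intro x hx
    rw [eq_empty_iff_forall_notMem]
    rintro y ⟨hyω, hyJ⟩
    obtain ⟨σ, hσ, -, -, r, hr, -, hω⟩ := hM.exists_isSolution hf hx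
    have hyr : y ∈ M r := hω hyω
    obtain ⟨τ, hτ⟩ := subset_inv_of_image_eq (hM.isolated r).image_eq Subset.rfl hyr
    exact (hM.mem_of_omegaSet_subset hS hf hyJ
      (hτ.omegaSet_subset ((hM.isolated r).isCompact hf))).2 hr
  have hinvU₁ := hU₁.inv_eq hf
  have hinvU₀ := hU₀.inv_eq hf
  have hdual : morseSet f S M I = dualRepeller f U₁ (morseSet f S M J₀) := by
    apply Subset.antisymm
    · exact fun x hx => ⟨hinvU₁.symm.subset (morseSet_mono hIJ₁ hx), hmiss x hx⟩
    · rintro x ⟨hx, hxω⟩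
      rw [hinvU₁] at hx
      -- The ω-index cannot be in `J₀`, so it is in `I`. The α-index is then in `I` as well, since
      -- `J₀` is a lower set.
      have key : ∀ p, M p ∩ omegaSet f x ≠ ∅ → p ∉ J₀ := fun p hne hp => hne <| by
        rw [eq_empty_iff_forall_notMem] at hxω ⊢
        exact fun z hz => hxω z ⟨hz.2, Or.inl (mem_biUnion hp hz.1)⟩
      obtain ⟨σ, hσ, q, hq, r, hr, hα, hω⟩ := hM.exists_isSolution hf hx
      have hσS := hσ.mono hM.morseSet_subset
      have hne := hσS.omegaSet_nonempty hSc
      have hrI : r ∈ I := by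
        by_contra hrI
        exact key r (by rwa [inter_eq_right.2 hω, ← nonempty_iff_ne_empty]) ⟨hr, hrI⟩
      rcases hM.solution x hσS.mem σ hσS with ⟨p, hp⟩ | ⟨p', q', hpq, hp', hq'⟩
      · have hσp : IsSolution f (M p) x σ := ⟨hσ.1, fun n => ⟨hp n, (hσ.2 n).2⟩⟩
        obtain rfl := hM.index_eq hne (hσp.omegaSet_subset ((hM.isolated p).isCompact hf)) hω
        exact Or.inl (mem_biUnion hrI hσp.mem)
      · obtain rfl := hM.index_eq hne hp' hω
        obtain rfl := hM.index_eq (hσS.alphaSet_nonempty hSc) hq' hα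
        have hqI : q' ∈ I := by
          by_contra hqI
          exact (hJ₀l hpq.le ⟨hq, hqI⟩).2 hrI
        exact mem_morseSet hσS hqI hrI hα hω
  have hIU₀ : ∀ x ∈ morseSet f S M I, x ∉ U₀ := by
    intro x hx hxU
    have hmaps : MapsTo f U₀ U₀ :=
      mapsTo_iff_image_subset.2 (hU₀.image_subset.trans interior_subset)
    have hit : ∀ n, f^[n] x ∈ U₀ := fun n => hmaps.iterate n hxU
    obtain ⟨z, hz⟩ := omegaSet_nonempty hU₀.compact hit
    have hsub : omegaSet f x ⊆ morseSet f S M J₀ := hinvU₀ ▸ subset_inv_of_image_eq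
      (image_omegaSet hU₀.compact (hf.mono hU₀.subset_domain) hit) (omegaSet_subset hU₀.compact hit)
    exact (hmiss x hx).subset ⟨hz, hsub hz⟩
  have hcpt : IsCompact (U₁ \ interior U₀) := hU₁.compact.diff isOpen_interior
  have hint : morseSet f S M I ⊆ interior (U₁ \ interior U₀) := by
    refine Subset.trans ?_ (interior_maximal (t := interior U₁ \ U₀) ?_
      (isOpen_interior.sdiff hU₀.compact.isClosed))
    · exact fun x hx => ⟨hU₁.nbhd (morseSet_mono hIJ₁ hx), hIU₀ x hx⟩
    · exact sdiff_subset_sdiff interior_subset interior_subset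
  have hinv : morseSet f S M I = Inv f (U₁ \ interior U₀) := by
    apply Subset.antisymm
    · exact subset_inv_of_image_eq (hM.image_morseSet hf I) (hint.trans interior_subset)
    · rintro x ⟨σ, hσ⟩
      rw [hdual]
      refine ⟨⟨σ, hσ.mono sdiff_subset⟩, ?_⟩
      rw [eq_empty_iff_forall_notMem]
      rintro y ⟨hyω, hyJ⟩
      exact (hσ.omegaSet_subset hcpt hyω).2 (hU₀.nbhd hyJ)
  exact ⟨J₀, J₁, hJ₀l, hJ₁l, hdisj, hunion, U₀, U₁, inter_subset_right, hU₁Y, hU₀, hU₁, hdual,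
    ⟨hcpt, sdiff_subset.trans hU₁.subset_domain, hinv ▸ hint⟩, hinv⟩

end Realisation

/-! ### The pointed space -/

section PointedSpaceTopology

variable {X : Type*} {N L : Set X}

open Classical in
/-- The extension of the quotient map `N → N_L` by the base point. -/
noncomputable def collapseMap (N L : Set X) (x : X) : PointedSpace N L :=
  if h : x ∈ N then toPointed N L ⟨x, h⟩ else basePoint N L

theorem collapseMap_coe (x : N) : collapseMap N L x = toPointed N L x := by
  simp [collapseMap]

theorem toPointed_eq_basePoint {x : N} : toPointed N L x = basePoint N L ↔ (x : X) ∈ L := by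
  refine Quotient.eq.trans ⟨?_, fun h => Or.inr ⟨?_, fun _ h => by cases h⟩⟩
  · rintro (h | h)
    · cases h
    · exact h.1 x rfl
  · rintro y hy
    cases hy
    exact h

theorem toPointed_eq {x y : N} :
    toPointed N L x = toPointed N L y ↔ x = y ∨ ((x : X) ∈ L ∧ (y : X) ∈ L) := by
  constructor
  · intro h
    rcases Quotient.exact h with h | h
    · exact Or.inl (Sum.inl_injective h)
    · exact Or.inr ⟨h.1 x rfl, h.2 y rfl⟩
  · rintro (rfl | ⟨hx, hy⟩)
    · rfl
    · rw [toPointed_eq_basePoint.2 hx, toPointed_eq_basePoint.2 hy]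

theorem collapseMap_eq_basePoint {x : X} :
    collapseMap N L x = basePoint N L ↔ x ∉ N \ L := by
  by_cases h : x ∈ N
  · rw [show collapseMap N L x = toPointed N L ⟨x, h⟩ from collapseMap_coe ⟨x, h⟩,
      toPointed_eq_basePoint]
    simp [h]
  · simp [collapseMap, h]

theorem injOn_collapseMap : InjOn (collapseMap N L) (N \ L) := by
  intro x hx y hy h
  have h' : toPointed N L ⟨x, hx.1⟩ = toPointed N L ⟨y, hy.1⟩ := by
    rwa [← collapseMap_coe, ← collapseMap_coe]
  rcases toPointed_eq.1 h' with h | h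
  · exact congrArg Subtype.val h
  · exact absurd h.1 hx.2

theorem exists_collapseMap_eq {y : PointedSpace N L} (hy : y ≠ basePoint N L) :
    ∃ x ∈ N \ L, collapseMap N L x = y := by
  obtain ⟨a, rfl⟩ := Quotient.exists_rep y
  rcases a with x | u
  · refine ⟨x, ?_, collapseMap_coe x⟩
    by_contra h
    exact hy ((collapseMap_coe x).symm.trans (collapseMap_eq_basePoint.2 h))
  · exact absurd rfl hy

theorem pointedImage_eq {A : Set X} (hA : A ⊆ N) :
    pointedImage N L A = collapseMap N L '' A := by
  ext y
  constructor
  · rintro ⟨x, hx, rfl⟩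
    exact ⟨x, hx, collapseMap_coe x⟩
  · rintro ⟨x, hx, rfl⟩
    exact ⟨⟨x, hA hx⟩, hx, (collapseMap_coe ⟨x, hA hx⟩).symm⟩

theorem collapseMap_mem_image {O : Set X} (hO : Disjoint O L) {x : X} (hx : x ∈ N) :
    collapseMap N L x ∈ collapseMap N L '' (O ∩ N) ↔ x ∈ O := by
  refine ⟨?_, fun h => ⟨x, ⟨h, hx⟩, rfl⟩⟩
  rintro ⟨y, ⟨hyO, hyN⟩, hxy⟩
  have hy : y ∈ N \ L := ⟨hyN, disjoint_left.1 hO hyO⟩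
  have hxL : x ∈ N \ L := by
    by_contra h
    exact collapseMap_eq_basePoint.1 (hxy.trans (collapseMap_eq_basePoint.2 h)) hy
  exact injOn_collapseMap hy hxL hxy ▸ hyO

theorem basePoint_notMem_image {O : Set X} (hLO : L ⊆ O) :
    basePoint N L ∉ collapseMap N L '' (Oᶜ ∩ N) := by
  rintro ⟨x, ⟨hxO, hxN⟩, hx⟩
  exact collapseMap_eq_basePoint.1 hx ⟨hxN, fun h => hxO (hLO h)⟩

variable [TopologicalSpace X]

/-- The added point is isolated in the sum, so openness is decided on `N` alone. -/
theorem isOpen_pointed_iff {W : Set (PointedSpace N L)} :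
    IsOpen W ↔ IsOpen {x : N | collapseMap N L x ∈ W} := by
  have h : IsOpen W ↔ IsOpen (Quotient.mk (collapseSetoid N L) ⁻¹' W) := Iff.rfl
  rw [h, isOpen_sum_iff, and_iff_left (isOpen_discrete _)]
  simp only [collapseMap_coe]
  rfl

theorem continuous_pointed_iff {Z : Type*} [TopologicalSpace Z] {g : PointedSpace N L → Z} :
    Continuous g ↔ Continuous fun x : N => g (collapseMap N L x) := by
  simp only [continuous_def, isOpen_pointed_iff]
  rfl

theorem continuousOn_collapseMap : ContinuousOn (collapseMap N L) N := by
  rw [continuousOn_iff_continuous_domRestrict]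
  exact continuous_pointed_iff.1 continuous_id

theorem isOpen_image_collapseMap {O : Set X} (hO : IsOpen O) (hOL : Disjoint O L) :
    IsOpen (collapseMap N L '' (O ∩ N)) := by
  rw [isOpen_pointed_iff]
  convert hO.preimage (continuous_subtype_val (p := (· ∈ N))) using 1
  ext x
  exact collapseMap_mem_image hOL x.2

/-- An open set that contains `L` gives an open neighbourhood of the base point. -/
theorem isOpen_compl_image_collapseMap {O : Set X} (hO : IsOpen O) (hLO : L ⊆ O) :
    IsOpen (collapseMap N L '' (Oᶜ ∩ N))ᶜ := by
  rw [isOpen_pointed_iff]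
  convert hO.preimage (continuous_subtype_val (p := (· ∈ N))) using 1
  ext x
  have := collapseMap_mem_image (disjoint_compl_left_iff_subset.2 hLO) x.2
  simp only [mem_ofPred_eq, mem_compl_iff, mem_preimage, this, not_not]

theorem continuousAt_collapseMap {x : X} (hx : x ∈ interior N ∨ x ∉ closure (N \ L)) :
    ContinuousAt (collapseMap N L) x := by
  rcases hx with hx | hx
  · exact continuousOn_collapseMap.continuousAt (mem_interior_iff_mem_nhds.1 hx)
  · refine (continuousAt_const (y := basePoint N L)).congr ?_
    filter_upwards [isClosed_closure.isOpen_compl.mem_nhds hx] with y hy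
    exact (collapseMap_eq_basePoint.2 fun h => hy (subset_closure h)).symm

theorem compactSpace_pointed (hN : IsCompact N) : CompactSpace (PointedSpace N L) := by
  have := isCompact_iff_compactSpace.1 hN
  exact inferInstanceAs (CompactSpace (Quotient (collapseSetoid N L)))

theorem t2Space_pointed [T2Space X] (hL : IsCompact L) : T2Space (PointedSpace N L) := by
  have hbase : ∀ x ∈ N \ L, ∃ W₁ W₂ : Set (PointedSpace N L), IsOpen W₁ ∧ IsOpen W₂ ∧
      collapseMap N L x ∈ W₁ ∧ basePoint N L ∈ W₂ ∧ Disjoint W₁ W₂ := by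
    intro x hx
    obtain ⟨O₁, O₂, h₁, h₂, hx₁, hL₂, hd⟩ := SeparatedNhds.of_isCompact_isCompact
      (isCompact_singleton (x := x)) hL (disjoint_singleton_left.2 hx.2)
    refine ⟨_, _, isOpen_image_collapseMap h₁ (hd.mono_right hL₂),
      isOpen_compl_image_collapseMap h₂ hL₂, ⟨x, ⟨hx₁ rfl, hx.1⟩, rfl⟩,
      basePoint_notMem_image hL₂, ?_⟩
    exact disjoint_compl_right_iff_subset.2
      (image_mono (inter_subset_inter_left _ hd.subset_compl_right))
  refine ⟨fun y₁ y₂ hne => ?_⟩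
  by_cases h₁ : y₁ = basePoint N L
  · obtain ⟨x, hx, rfl⟩ := exists_collapseMap_eq (h₁ ▸ hne.symm : y₂ ≠ basePoint N L)
    obtain ⟨W₁, W₂, ho₁, ho₂, hm₁, hm₂, hd⟩ := hbase x hx
    exact ⟨W₂, W₁, ho₂, ho₁, h₁ ▸ hm₂, hm₁, hd.symm⟩
  by_cases h₂ : y₂ = basePoint N L
  · obtain ⟨x, hx, rfl⟩ := exists_collapseMap_eq h₁
    obtain ⟨W₁, W₂, ho₁, ho₂, hm₁, hm₂, hd⟩ := hbase x hx
    exact ⟨W₁, W₂, ho₁, ho₂, hm₁, h₂ ▸ hm₂, hd⟩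
  obtain ⟨x₁, hx₁, rfl⟩ := exists_collapseMap_eq h₁
  obtain ⟨x₂, hx₂, rfl⟩ := exists_collapseMap_eq h₂
  obtain ⟨O₁, O₂, ho₁, ho₂, hm₁, hm₂, hd⟩ := t2_separation fun h : x₁ = x₂ => hne (by rw [h])
  refine ⟨_, _, isOpen_image_collapseMap (ho₁.sdiff hL.isClosed) disjoint_sdiff_left,
    isOpen_image_collapseMap (ho₂.sdiff hL.isClosed) disjoint_sdiff_left,
    ⟨x₁, ⟨⟨hm₁, hx₁.2⟩, hx₁.1⟩, rfl⟩, ⟨x₂, ⟨⟨hm₂, hx₂.2⟩, hx₂.1⟩, rfl⟩, ?_⟩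
  rw [disjoint_left]
  rintro _ ⟨z, hz, rfl⟩ hz'
  exact disjoint_left.1 hd hz.1.1 ((collapseMap_mem_image disjoint_sdiff_left hz.2).1 hz').1

end PointedSpaceTopology

/-! ### The pointed space map of a filtration pair -/

section PointedMap

variable {X : Type*} [TopologicalSpace X] {f : X → X} {D S N L : Set X}

omit [TopologicalSpace X] in
theorem pointedMap_basePoint : pointedMap f N L (basePoint N L) = basePoint N L := rfl

omit [TopologicalSpace X] in
theorem eq_basePoint_of_le {T : Set (PointedSpace N L)} {y : PointedSpace N L}
    {σ : ℤ → PointedSpace N L} (hσ : IsSolution (pointedMap f N L) T y σ) {m n : ℤ} (hmn : m ≤ n)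
    (hm : σ m = basePoint N L) : σ n = basePoint N L := by
  obtain ⟨k, rfl⟩ := Int.le.dest hmn
  rw [← hσ.iterate_add m k, hm]
  exact Function.iterate_fixed pointedMap_basePoint k

namespace IsFiltrationPair

theorem map_notMem (h : IsFiltrationPair f D S N L) {x : X} (hx : x ∈ L) :
    f x ∉ closure (N \ L) := fun hfx =>
  h.disjoint_image.subset ⟨⟨x, hx, rfl⟩, hfx⟩

theorem exitSet_subset (h : IsFiltrationPair f D S N L) : exitSet f N ⊆ L := by
  obtain ⟨O, -, hO, hOL⟩ := h.nbhd_exit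
  exact fun x hx => hOL ⟨hO hx, hx.1⟩

/-- These are the two regions where `collapseMap` is continuous on all of `X`: inside `N`, and away
from `closure (N \ L)`, where it is locally constant. Continuity of `f_P` follows. -/
theorem map_mem (h : IsFiltrationPair f D S N L) {x : X} (hx : x ∈ N) :
    f x ∈ interior N ∨ f x ∉ closure (N \ L) := by
  by_contra! hc
  exact h.map_notMem (h.exitSet_subset ⟨hx, hc.1⟩) hc.2

theorem pointedMap_collapseMap (h : IsFiltrationPair f D S N L) {x : X} (hx : x ∈ N) :
    pointedMap f N L (collapseMap N L x) = collapseMap N L (f x) := by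
  by_cases hxL : x ∈ L
  · rw [collapseMap_eq_basePoint.2 fun hx => hx.2 hxL, pointedMap_basePoint, eq_comm,
      collapseMap_eq_basePoint]
    exact fun hfx => h.map_notMem hxL (subset_closure hfx)
  · have hfx : f x ∈ N := by
      by_contra hfx
      exact hxL (h.exitSet_subset ⟨hx, fun hi => hfx (interior_subset hi)⟩)
    rw [show collapseMap N L x = toPointed N L ⟨x, hx⟩ from collapseMap_coe ⟨x, hx⟩,
      show collapseMap N L (f x) = toPointed N L ⟨f x, hfx⟩ from collapseMap_coe ⟨f x, hfx⟩]
    exact dif_pos ⟨hxL, hfx⟩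

theorem continuousAt (h : IsFiltrationPair f D S N L) (hf : ContinuousOn f D) {x : X}
    (hx : x ∈ N) : ContinuousAt f x :=
  hf.continuousAt (mem_interior_iff_mem_nhds.1 (h.N_subset hx))

theorem continuous_pointedMap (h : IsFiltrationPair f D S N L) (hf : ContinuousOn f D) :
    Continuous (pointedMap f N L) := by
  rw [continuous_pointed_iff, continuous_iff_continuousAt]
  intro x
  have hc : ContinuousAt (fun x : N => collapseMap N L (f x)) x :=
    ContinuousAt.comp (f := fun x : N => f x) (continuousAt_collapseMap (h.map_mem x.2))
      ((h.continuousAt hf x.2).comp continuousAt_subtype_val)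
  exact hc.congr (Filter.Eventually.of_forall fun y => (h.pointedMap_collapseMap y.2).symm)

theorem eq_map_of_pointedMap_eq (h : IsFiltrationPair f D S N L) {x y : X} (hx : x ∈ N \ L)
    (hy : y ∈ N \ L) (hxy : pointedMap f N L (collapseMap N L x) = collapseMap N L y) :
    f x = y := by
  rw [h.pointedMap_collapseMap hx.1] at hxy
  refine injOn_collapseMap ?_ hy hxy
  by_contra hfx
  exact collapseMap_eq_basePoint.1 (hxy.symm.trans (collapseMap_eq_basePoint.2 hfx)) hy

theorem iterate_pointedMap (h : IsFiltrationPair f D S N L) {x : X} (hx : ∀ n, f^[n] x ∈ N)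
    (n : ℕ) : (pointedMap f N L)^[n] (collapseMap N L x) = collapseMap N L (f^[n] x) := by
  induction n with
  | zero => rfl
  | succ k ih =>
    rw [Function.iterate_succ_apply', ih, h.pointedMap_collapseMap (hx k),
      Function.iterate_succ_apply']

theorem isSolution_collapseMap (h : IsFiltrationPair f D S N L) {A : Set X} (hA : A ⊆ N) {x : X}
    {σ : ℤ → X} (hσ : IsSolution f A x σ) :
    IsSolution (pointedMap f N L) (collapseMap N L '' A) (collapseMap N L x)
      fun n => collapseMap N L (σ n) :=
  ⟨congrArg _ hσ.1, fun n => ⟨mem_image_of_mem _ (hσ.2 n).1, by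
    rw [h.pointedMap_collapseMap (hA (hσ.2 n).1), (hσ.2 n).2]⟩⟩

theorem exists_lift (h : IsFiltrationPair f D S N L) {T : Set (PointedSpace N L)}
    {y : PointedSpace N L} {σ : ℤ → PointedSpace N L}
    (hσ : IsSolution (pointedMap f N L) T y σ) (hne : ∀ n, σ n ≠ basePoint N L) :
    ∃ τ : ℤ → X, IsSolution f (N \ L) (τ 0) τ ∧ ∀ n, collapseMap N L (τ n) = σ n := by
  choose τ hτ hτσ using fun n => exists_collapseMap_eq (hne n)
  refine ⟨τ, ⟨rfl, fun n => ⟨hτ n, h.eq_map_of_pointedMap_eq (hτ n) (hτ _) ?_⟩⟩, hτσ⟩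
  rw [hτσ, hτσ, (hσ.2 n).2]

theorem image_eq (h : IsFiltrationPair f D S N L) : f '' S = S := by
  rw [h.inv_eq, image_inv]

theorem subset_interior (h : IsFiltrationPair f D S N L) : S ⊆ interior (closure (N \ L)) := by
  rw [h.inv_eq]
  exact h.isolating.2.2

theorem disjoint_L (h : IsFiltrationPair f D S N L) : Disjoint S L :=
  disjoint_left.2 fun x hx hxL =>
    h.map_notMem hxL (interior_subset (h.subset_interior (h.image_eq.subset ⟨x, hx, rfl⟩)))

theorem isolatedInvariant (h : IsFiltrationPair f D S N L) : IsIsolatedInvariant f D S :=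
  ⟨_, h.isolating, h.inv_eq⟩

theorem isSolution_of_diff (h : IsFiltrationPair f D S N L) {x : X} {σ : ℤ → X}
    (hσ : IsSolution f (N \ L) x σ) : IsSolution f S x σ := by
  rw [h.inv_eq]
  exact (hσ.mono subset_closure).to_inv

variable [T2Space X]

theorem closure_diff_subset (h : IsFiltrationPair f D S N L) : closure (N \ L) ⊆ N :=
  closure_minimal sdiff_subset h.compact_N.isClosed

theorem subset_diff (h : IsFiltrationPair f D S N L) : S ⊆ N \ L := fun _ hx =>
  ⟨h.closure_diff_subset (interior_subset (h.subset_interior hx)), disjoint_left.1 h.disjoint_L hx⟩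

/-- There is a compact neighbourhood of `S` that is disjoint from `L` and contained in `N`. -/
theorem exists_compact_nhd [LocallyCompactSpace X] (h : IsFiltrationPair f D S N L)
    (hf : ContinuousOn f D) : ∃ C : Set X, IsCompact C ∧ S ⊆ interior C ∧ C ⊆ N \ L := by
  obtain ⟨C, hC, hSC, hCN⟩ := exists_compact_between (h.isolatedInvariant.isCompact hf)
    (isOpen_interior.sdiff h.compact_L.isClosed : IsOpen (interior (closure (N \ L)) \ L))
    fun x hx => ⟨h.subset_interior hx, (h.subset_diff hx).2⟩
  exact ⟨C, hC, hSC, hCN.trans (sdiff_subset_sdiff_left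
    (interior_subset.trans h.closure_diff_subset))⟩

theorem omegaSet_collapseMap (h : IsFiltrationPair f D S N L) {x : X} (hx : ∀ n, f^[n] x ∈ N) :
    omegaSet (pointedMap f N L) (collapseMap N L x) = collapseMap N L '' omegaSet f x := by
  have := t2Space_pointed (N := N) h.compact_L
  have htail : ∀ n : ℕ, {y | ∃ m : ℕ, n < m ∧ (pointedMap f N L)^[m] (collapseMap N L x) = y} =
      collapseMap N L '' {y | ∃ m : ℕ, n < m ∧ f^[m] x = y} := by
    intro n
    ext y
    simp only [h.iterate_pointedMap hx, mem_ofPred_eq, mem_image]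
    constructor
    · rintro ⟨m, hm, rfl⟩
      exact ⟨_, ⟨m, hm, rfl⟩, rfl⟩
    · rintro ⟨_, ⟨m, hm, rfl⟩, rfl⟩
      exact ⟨m, hm, rfl⟩
  simp only [omegaSet, htail]
  exact (iInter_closure_image_subset h.compact_N continuousOn_collapseMap
    (antitone_omega_tail f x) (omega_tail_subset hx)).antisymm
    (image_iInter_closure_subset h.compact_N continuousOn_collapseMap (omega_tail_subset hx))

theorem alphaSet_collapseMap (h : IsFiltrationPair f D S N L) {σ : ℤ → X}
    {σ' : ℤ → PointedSpace N L} (hσ : ∀ n : ℕ, σ (-(n : ℤ)) ∈ N)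
    (hσ' : ∀ n : ℕ, collapseMap N L (σ (-(n : ℤ))) = σ' (-(n : ℤ))) :
    alphaSet σ' = collapseMap N L '' alphaSet σ := by
  have := t2Space_pointed (N := N) h.compact_L
  have htail : ∀ n : ℕ, {y | ∃ m : ℕ, n < m ∧ σ' (-(m : ℤ)) = y} =
      collapseMap N L '' {y | ∃ m : ℕ, n < m ∧ σ (-(m : ℤ)) = y} := by
    intro n
    ext y
    simp only [← hσ', mem_ofPred_eq, mem_image]
    constructor
    · rintro ⟨m, hm, rfl⟩
      exact ⟨_, ⟨m, hm, rfl⟩, rfl⟩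
    · rintro ⟨_, ⟨m, hm, rfl⟩, rfl⟩
      exact ⟨m, hm, rfl⟩
  simp only [alphaSet, htail]
  exact (iInter_closure_image_subset h.compact_N continuousOn_collapseMap
    (antitone_alpha_tail σ) (alpha_tail_subset hσ)).antisymm
    (image_iInter_closure_subset h.compact_N continuousOn_collapseMap (alpha_tail_subset hσ))

/-- The base point attracts a neighbourhood of itself in one step, so it is isolated invariant. -/
theorem isIsolatedInvariant_basePoint (h : IsFiltrationPair f D S N L) (hf : ContinuousOn f D) :
    IsIsolatedInvariant (pointedMap f N L) univ {basePoint N L} := by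
  have := t2Space_pointed (N := N) h.compact_L
  have := compactSpace_pointed (L := L) h.compact_N
  -- A neighbourhood of `L` whose points in `N` are sent to the base point in one step.
  let O : Set X := interior D ∩ f ⁻¹' (closure (N \ L))ᶜ
  have hO : IsOpen O := (hf.mono interior_subset).isOpen_inter_preimage isOpen_interior
    isClosed_closure.isOpen_compl
  have hLO : L ⊆ O := fun x hx => ⟨h.N_subset (h.L_subset_N hx), h.map_notMem hx⟩
  obtain ⟨K, hK, hbK, hKW⟩ := exists_compact_subset
    (isOpen_compl_image_collapseMap (N := N) hO hLO) (basePoint_notMem_image hLO)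
  have hKb : ∀ y ∈ K, pointedMap f N L y = basePoint N L := by
    intro y hy
    by_cases hyb : y = basePoint N L
    · rw [hyb, pointedMap_basePoint]
    · obtain ⟨x, hx, rfl⟩ := exists_collapseMap_eq hyb
      rw [h.pointedMap_collapseMap hx.1, collapseMap_eq_basePoint]
      intro hfx
      exact hKW hy ⟨x, ⟨fun hxO => hxO.2 (subset_closure hfx), hx.1⟩, rfl⟩
  have hinv : Inv (pointedMap f N L) K = {basePoint N L} := by
    apply Subset.antisymm
    · rintro y hy
      obtain ⟨z, hz, rfl⟩ := image_inv.symm.subset hy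
      exact hKb z (inv_subset hz)
    · rintro _ rfl
      exact ⟨fun _ => basePoint N L, rfl, fun _ => ⟨interior_subset hbK, rfl⟩⟩
  exact ⟨K, ⟨hK, subset_univ _, hinv.subset.trans (singleton_subset_iff.2 hbK)⟩, hinv.symm⟩

theorem isIsolatedInvariant_image [LocallyCompactSpace X] (h : IsFiltrationPair f D S N L)
    (hf : ContinuousOn f D) {A : Set X} (hAS : A ⊆ S) (hA : IsIsolatedInvariant f D A) :
    IsIsolatedInvariant (pointedMap f N L) univ (collapseMap N L '' A) := by
  obtain ⟨C, hC, hSC, hCN⟩ := h.exists_compact_nhd hf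
  obtain ⟨V, hV, hAV⟩ := hA
  have hVN : V ∩ C ⊆ N \ L := inter_subset_right.trans hCN
  have hAint : A ⊆ interior V ∩ interior C := subset_inter (hAV ▸ hV.2.2) (hAS.trans hSC)
  have hAsub : A ⊆ V ∩ C := hAint.trans (inter_subset_inter interior_subset interior_subset)
  have hopen : IsOpen (collapseMap N L '' (interior V ∩ interior C)) := by
    have hsub : interior V ∩ interior C ⊆ N \ L :=
      (inter_subset_inter interior_subset interior_subset).trans hVN
    have := isOpen_image_collapseMap (N := N) (L := L)
      ((isOpen_interior (s := V)).inter (isOpen_interior (s := C)))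
      (disjoint_left.2 fun x hx => (hsub hx).2)
    rwa [inter_eq_left.2 fun x hx => (hsub hx).1] at this
  have hinv : Inv (pointedMap f N L) (collapseMap N L '' (V ∩ C)) = collapseMap N L '' A := by
    apply Subset.antisymm
    · rintro y ⟨σ, hσ⟩
      obtain ⟨τ, hτ, hτσ⟩ := h.exists_lift hσ fun n hb => by
        obtain ⟨x, hx, hxσ⟩ := (hσ.2 n).1
        exact collapseMap_eq_basePoint.1 (hxσ.trans hb) (hVN hx)
      refine ⟨τ 0, hAV ▸ ⟨τ, rfl, fun n => ⟨?_, (hτ.2 n).2⟩⟩, (hτσ 0).trans hσ.1⟩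
      obtain ⟨x, hx, hxσ⟩ := (hσ.2 n).1
      rw [← injOn_collapseMap (hVN hx) (hτ.2 n).1 (hxσ.trans (hτσ n).symm)]
      exact hx.1
    · rintro _ ⟨x, hx, rfl⟩
      obtain ⟨σ, hσ⟩ : x ∈ Inv f A := by rwa [hAV, inv_inv, ← hAV]
      exact ⟨_, (h.isSolution_collapseMap (hAS.trans (h.subset_diff.trans sdiff_subset)) hσ).mono
        (image_mono hAsub)⟩
  refine ⟨_, ⟨(hV.1.inter hC).image_of_continuousOn
    (continuousOn_collapseMap.mono (hVN.trans sdiff_subset)), subset_univ _, ?_⟩, hinv.symm⟩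
  rw [hinv]
  exact (image_mono hAint).trans (interior_maximal
    (image_mono (inter_subset_inter interior_subset interior_subset)) hopen)

variable {P : Type*} [PartialOrder P] {M : P → Set X}

theorem associatedMorse_coe (h : IsFiltrationPair f D S N L) (hM : IsMorseDecomposition f D S M)
    (p : P) : associatedMorse N L M (p : WithBot P) = collapseMap N L '' M p :=
  pointedImage_eq ((hM.subset p).trans (h.subset_diff.trans sdiff_subset))

theorem omegaSet_subset_basePoint (h : IsFiltrationPair f D S N L) {T : Set (PointedSpace N L)}
    {y : PointedSpace N L} {σ : ℤ → PointedSpace N L}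
    (hσ : IsSolution (pointedMap f N L) T y σ) {m : ℤ} (hm : σ m = basePoint N L) :
    omegaSet (pointedMap f N L) y ⊆ {basePoint N L} := by
  have := t2Space_pointed (N := N) h.compact_L
  rw [← hσ.omegaSet_eq m, hm]
  exact omegaSet_subset isCompact_singleton fun n =>
    Function.iterate_fixed pointedMap_basePoint n

/-- A solution avoiding the base point lifts to a solution in `S`. One that reaches it from
elsewhere has ω-limit set at the base point, and its α-limit set is found from the backward half
that lifts. -/
theorem isMorseDecomposition [LocallyCompactSpace X] [Finite P]
    (h : IsFiltrationPair f D S N L) (hD : IsOpen D) (hf : ContinuousOn f D)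
    (hM : IsMorseDecomposition f D S M) :
    IsMorseDecomposition (pointedMap f N L) univ (Inv (pointedMap f N L) univ)
      (associatedMorse N L M) := by
  have hne : ∀ p : P, basePoint N L ∉ collapseMap N L '' M p := by
    rintro p ⟨x, hx, hxb⟩
    exact collapseMap_eq_basePoint.1 hxb (h.subset_diff (hM.subset p hx))
  have hiso : ∀ p : WithBot P,
      IsIsolatedInvariant (pointedMap f N L) univ (associatedMorse N L M p) := by
    intro p
    induction p with
    | bot => exact h.isIsolatedInvariant_basePoint hf
    | coe p =>
      rw [h.associatedMorse_coe hM]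
      exact h.isIsolatedInvariant_image hf (hM.subset p) (hM.isolated p)
  refine ⟨fun p => subset_inv_of_image_eq (hiso p).image_eq (subset_univ _), hiso, ?_, ?_⟩
  · intro p q hpq
    induction p with
    | bot =>
      induction q with
      | bot => exact absurd rfl hpq
      | coe q =>
        rw [h.associatedMorse_coe hM]
        exact disjoint_singleton_left.2 (hne q)
    | coe p =>
      induction q with
      | bot =>
        rw [h.associatedMorse_coe hM]
        exact disjoint_singleton_right.2 (hne p)
      | coe q =>
        rw [h.associatedMorse_coe hM, h.associatedMorse_coe hM]
        rw [disjoint_iff_inter_eq_empty, ← injOn_collapseMap.image_inter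
          ((hM.subset p).trans h.subset_diff) ((hM.subset q).trans h.subset_diff),
          (hM.disjoint p q fun e => hpq (by rw [e])).inter_eq, image_empty]
  · intro y _ σ hσ
    by_cases hb : ∃ m, σ m = basePoint N L
    · obtain ⟨m, hm⟩ := hb
      by_cases hall : ∀ n, σ n = basePoint N L
      · exact Or.inl ⟨⊥, hall⟩
      push Not at hall
      obtain ⟨n₀, hn₀⟩ := hall
      have hlt : ∀ n : ℕ, σ (n₀ + -(n : ℤ)) ≠ basePoint N L := fun n hn =>
        hn₀ (eq_basePoint_of_le hσ (by omega) hn)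
      choose b hbN hbσ using fun n => exists_collapseMap_eq (hlt n)
      -- Only the values at nonpositive times matter; `natAbs` merely fills in the rest.
      let τ : ℤ → X := fun n => b n.natAbs
      have hτ : ∀ n : ℕ, τ (-(n : ℤ)) = b n := fun n => by simp [τ]
      obtain ⟨q, hq⟩ := hM.exists_alphaSet_subset h.isolatedInvariant hD hf h.isolating.1
        h.isolating.2.1 h.inv_eq.symm (σ := τ) (fun n => by
          rw [hτ]; exact subset_closure (hbN n)) (fun n => by
          rw [hτ, hτ]
          refine h.eq_map_of_pointedMap_eq (hbN _) (hbN _) ?_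
          rw [hbσ, hbσ, (hσ.2 _).2]
          congr 1
          push_cast
          ring)
      refine Or.inr ⟨⊥, q, WithBot.bot_lt_coe q, h.omegaSet_subset_basePoint hσ hm, ?_⟩
      have hshift := alphaSet_shift_subset (fun n => σ (n₀ + n)) (-n₀)
      simp only [add_neg_cancel_left] at hshift
      rw [h.associatedMorse_coe hM]
      refine hshift.trans ?_
      rw [h.alphaSet_collapseMap (σ := τ) (fun n => by rw [hτ]; exact (hbN n).1)
        (fun n => by rw [hτ, hbσ])]
      exact image_mono hq
    · push Not at hb
      obtain ⟨τ, hτ, hτσ⟩ := h.exists_lift hσ hb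
      have hτS := h.isSolution_of_diff hτ
      rcases hM.solution _ hτS.mem τ hτS with ⟨p, hp⟩ | ⟨p, q, hpq, hω, hα⟩
      · refine Or.inl ⟨p, fun n => ?_⟩
        rw [h.associatedMorse_coe hM]
        exact ⟨τ n, hp n, hτσ n⟩
      · refine Or.inr ⟨p, q, WithBot.coe_lt_coe.2 hpq, ?_, ?_⟩
        · rw [h.associatedMorse_coe hM, ← hσ.1, ← hτσ, h.omegaSet_collapseMap fun n => by
            rw [hτ.iterate]; exact (hτ.2 _).1.1]
          exact image_mono hω
        · rw [h.associatedMorse_coe hM, h.alphaSet_collapseMap (fun n => (hτ.2 _).1.1)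
            (fun n => hτσ _)]
          exact image_mono hα

theorem morseSet_pointed [LocallyCompactSpace X] [Finite P]
    (h : IsFiltrationPair f D S N L) (hD : IsOpen D) (hf : ContinuousOn f D)
    (hM : IsMorseDecomposition f D S M) (I : Set P) :
    morseSet (pointedMap f N L) (Inv (pointedMap f N L) univ) (associatedMorse N L M)
      ((fun p : P => (p : WithBot P)) '' I) = collapseMap N L '' morseSet f S M I := by
  have := t2Space_pointed (N := N) h.compact_L
  have := compactSpace_pointed (L := L) h.compact_N
  have hSN : S ⊆ N := h.subset_diff.trans sdiff_subset
  have hM' := h.isMorseDecomposition hD hf hM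
  have hf' := (h.continuous_pointedMap hf).continuousOn (s := univ)
  apply Subset.antisymm
  · intro y hy
    obtain ⟨σ, hσ, -, ⟨q, hq, rfl⟩, -, ⟨r, hr, rfl⟩, hα, hω⟩ := hM'.exists_isSolution hf' hy
    rw [h.associatedMorse_coe hM] at hα hω
    -- A solution that hit the base point would have its ω-limit set there, outside every `M r` with
    -- `r ∈ I`.
    obtain ⟨τ, hτ, hτσ⟩ := h.exists_lift hσ fun n hn => by
      obtain ⟨z, hz⟩ := omegaSet_nonempty (f := pointedMap f N L) (x := y) isCompact_univ
        fun _ => mem_univ _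
      obtain rfl : z = basePoint N L := h.omegaSet_subset_basePoint hσ hn hz
      obtain ⟨x, hx, hxb⟩ := hω hz
      exact collapseMap_eq_basePoint.1 hxb (h.subset_diff (hM.subset r hx))
    have hτS := h.isSolution_of_diff hτ
    have hSc := h.isolatedInvariant.isCompact hf
    rw [h.alphaSet_collapseMap (fun n => (hτ.2 _).1.1) (fun n => hτσ _),
      injOn_collapseMap.image_subset_image_iff ((hτS.alphaSet_subset hSc).trans h.subset_diff)
      ((hM.subset q).trans h.subset_diff)] at hα
    rw [← hσ.1, ← hτσ, h.omegaSet_collapseMap fun n => by rw [hτ.iterate]; exact (hτ.2 _).1.1,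
      injOn_collapseMap.image_subset_image_iff ((hτS.omegaSet_subset hSc).trans h.subset_diff)
      ((hM.subset r).trans h.subset_diff)] at hω
    exact ⟨τ 0, mem_morseSet hτS hq hr hα hω, (hτσ 0).trans hσ.1⟩
  · rintro _ ⟨x, hx, rfl⟩
    obtain ⟨σ, hσ, q, hq, r, hr, hα, hω⟩ := hM.exists_isSolution hf hx
    have hσN := fun n => (hM.morseSet_subset.trans hSN) (hσ.2 n).1
    refine mem_morseSet (q := (q : WithBot P)) (r := (r : WithBot P))
      ((h.isSolution_collapseMap (hM.morseSet_subset.trans hSN) hσ).mono (subset_univ _)).to_inv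
      ⟨q, hq, rfl⟩ ⟨r, hr, rfl⟩ ?_ ?_
    · rw [h.associatedMorse_coe hM, h.alphaSet_collapseMap (fun n => hσN _) (fun n => rfl)]
      exact image_mono hα
    · rw [h.associatedMorse_coe hM, h.omegaSet_collapseMap fun n => by
        rw [hσ.iterate]; exact hσN _]
      exact image_mono hω

theorem isRealisedBetween [LocallyCompactSpace X] [Finite P]
    (h : IsFiltrationPair f D S N L) (hD : IsOpen D) (hf : ContinuousOn f D)
    (hM : IsMorseDecomposition f D S M) {I : Set P} (hI : I.OrdConnected) :
    IsRealisedBetween (pointedMap f N L) univ (Inv (pointedMap f N L) univ)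
      (associatedMorse N L M) ((fun p : P => (p : WithBot P)) '' I) univ
      (pointedImage N L (morseSet f S M I)) := by
  have := t2Space_pointed (N := N) h.compact_L
  have := compactSpace_pointed (L := L) h.compact_N
  have : Finite (WithBot P) := inferInstanceAs (Finite (Option P))
  -- A compact Hausdorff space has a compatible uniformity, which is all the pseudo-orbit argument
  -- needs; no metric on the quotient is required.
  let : UniformSpace (PointedSpace N L) := uniformSpaceOfCompactR1
  have hI' : ((fun p : P => (p : WithBot P)) '' I).OrdConnected := by
    refine ⟨?_⟩
    rintro _ ⟨p, hp, rfl⟩ _ ⟨q, hq, rfl⟩ r ⟨hpr, hrq⟩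
    induction r with
    | bot => exact absurd hpr (WithBot.not_coe_le_bot p)
    | coe r => exact ⟨r, hI.out hp hq ⟨WithBot.coe_le_coe.1 hpr, WithBot.coe_le_coe.1 hrq⟩, rfl⟩
  rw [pointedImage_eq (hM.morseSet_subset.trans (h.subset_diff.trans sdiff_subset)),
    ← h.morseSet_pointed hD hf hM]
  exact (h.isMorseDecomposition hD hf hM).isRealisedBetween isCompact_univ (subset_univ _)
    (by simp) isOpen_univ (h.continuous_pointedMap hf).continuousOn hI'

theorem isIsolatedInvariant_of_image [LocallyCompactSpace X] (h : IsFiltrationPair f D S N L)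
    (hf : ContinuousOn f D) {A : Set X} (hAS : A ⊆ S) (hA : f '' A = A)
    (hA' : IsIsolatedInvariant (pointedMap f N L) univ (collapseMap N L '' A)) :
    IsIsolatedInvariant f D A := by
  have := t2Space_pointed (N := N) h.compact_L
  obtain ⟨C, hC, hSC, hCN⟩ := h.exists_compact_nhd hf
  obtain ⟨K, ⟨hK, -, hKint⟩, hAK⟩ := hA'
  have hcont : ContinuousOn (collapseMap N L) C :=
    continuousOn_collapseMap.mono (hCN.trans sdiff_subset)
  have hcpt : IsCompact (C ∩ collapseMap N L ⁻¹' K) := hC.of_isClosed_subset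
    (hcont.preimage_isClosed_of_isClosed hC.isClosed hK.isClosed) inter_subset_left
  have hint : A ⊆ interior (C ∩ collapseMap N L ⁻¹' K) := by
    refine Subset.trans (fun x hx => ?_) (interior_maximal
      (inter_subset_inter interior_subset (preimage_mono interior_subset))
      ((hcont.mono interior_subset).isOpen_inter_preimage isOpen_interior isOpen_interior))
    exact ⟨hSC (hAS hx), hKint (hAK.subset ⟨x, hx, rfl⟩)⟩
  have hinv : Inv f (C ∩ collapseMap N L ⁻¹' K) = A := by
    refine Subset.antisymm ?_ (subset_inv_of_image_eq hA (hint.trans interior_subset))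
    rintro x ⟨σ, hσ⟩
    have hσN : IsSolution f (N \ L) x σ := hσ.mono (inter_subset_left.trans hCN)
    have hx : collapseMap N L x ∈ Inv (pointedMap f N L) K :=
      ⟨_, (h.isSolution_collapseMap (inter_subset_left.trans (hCN.trans sdiff_subset)) hσ).mono
        (image_subset_iff.2 inter_subset_right)⟩
    rw [← hAK] at hx
    obtain ⟨z, hz, hzx⟩ := hx
    exact injOn_collapseMap (h.subset_diff (hAS hz)) hσN.mem hzx ▸ hz
  exact ⟨_, ⟨hcpt, (inter_subset_left.trans (hCN.trans sdiff_subset)).trans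
    (h.N_subset.trans interior_subset), hinv.subset.trans hint⟩, hinv.symm⟩

end IsFiltrationPair

end PointedMap

end ConleyMorse

theorem mainTheorem10 {X : Type*} [MetricSpace X] [LocallyCompactSpace X]
    (U : Set X) (hU : IsOpen U) (f : X → X) (hf : ContinuousOn f U)
    {P : Type*} [Finite P] [PartialOrder P]
    (S : Set X) (hS : ConleyMorse.IsIsolatedInvariant f U S)
    (M : P → Set X) (hM : ConleyMorse.IsMorseDecomposition f U S M)
    (I : Set P) (hI : I.OrdConnected) :
    -- `M_I` is an isolated invariant set
    ConleyMorse.IsIsolatedInvariant f U (ConleyMorse.morseSet f S M I) ∧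
    -- realisation in `X` itself, when `S` is the maximal invariant set of a compact `Y`
    -- with `f(Y) ⊆ Int Y`
    (∀ Y : Set X, IsCompact Y → Y ⊆ U → f '' Y ⊆ interior Y → S = ConleyMorse.Inv f Y →
      ConleyMorse.IsRealisedBetween f U S M I Y (ConleyMorse.morseSet f S M I)) ∧
    -- realisation in the pointed space of a filtration pair, in general
    (∃ N L : Set X, ConleyMorse.IsFiltrationPair f U S N L) ∧
    (∀ N L : Set X, ConleyMorse.IsFiltrationPair f U S N L →
      ConleyMorse.IsRealisedBetween (ConleyMorse.pointedMap f N L) Set.univ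
        (ConleyMorse.Inv (ConleyMorse.pointedMap f N L) Set.univ)
        (ConleyMorse.associatedMorse N L M) ((fun p : P => (p : WithBot P)) '' I) Set.univ
        (ConleyMorse.pointedImage N L (ConleyMorse.morseSet f S M I))) := by
  obtain ⟨N, L, h⟩ := ConleyMorse.exists_isFiltrationPair hU hf hS
  refine ⟨?_, ?_, ⟨N, L, h⟩, fun N L h => h.isRealisedBetween hU hf hM hI⟩
  -- Isolation of `M_I` comes from the realisation in the pointed space, pulled back near `S`, where
  -- collapsing is injective.
  · refine h.isIsolatedInvariant_of_image hf hM.morseSet_subset (hM.image_morseSet hf I) ?_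
    rw [← ConleyMorse.pointedImage_eq (hM.morseSet_subset.trans (h.subset_diff.trans sdiff_subset))]
    obtain ⟨-, -, -, -, -, -, U₀, U₁, -, -, -, -, -, hiso, hinv⟩ := h.isRealisedBetween hU hf hM hI
    exact ⟨_, hiso, hinv⟩
  · rintro Y hY hYU hfY rfl
    exact hM.isRealisedBetween hY hYU hfY hU hf hI
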